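/- Let $X$ be a complete homogeneous geodesic metric space, that is, a complete metric space in which any two points are joined by an isometrically embedded segment and on which the isometry group acts transitively. Loops are continuous maps $\gamma:\partial\mathbb D\to X$ on the boundary of the closed unit disc $\mathbb D\subset\mathbb R^2$; $|\gamma|$ denotes the arc length. A partition of $\mathbb D$ is a finite collection $D_1,\dots,D_k$ of closed topological discs in the plane with pairwise disjoint interiors such that $\mathbb D=\bigcup_i D_i$ and $D_i\cap D_j=\partial D_i\cap\partial D_j$ for $i\ne j$. Its vertices are the points $p$ of the graph $\bigcup_i\partial D_i$ such that no open set $U\ni p$ meets the graph in a set homeomorphic to an interval; its edges are the segments into which the vertices cut the circles $\partial D_i$ (the whole circle if $k=1$). A partition $\Pi$ of a loop $\gamma$ is a map to $X$ from the vertex set of a partition of $\mathbb D$ that agrees with $\gamma$ at the vertices on $\partial\mathbb D$. The length of its $i$-th piece is the sum over the edges in $\partial D_i$ of the following lengths: the length of the corresponding subpath of $\gamma$ for an edge contained in $\partial\mathbb D$, and the distance between the images of the end points for any other edge (equivalently, the length of the loop obtained by mapping such edges to geodesic segments). The mesh of $\Pi$ is the maximal length of a piece. Let $P(\gamma,\delta)\in\mathbb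 N\cup\{\infty\}$ be the minimal number $k$ of pieces in a partition of $\gamma$ with mesh less than $\delta$ ($\infty$ if there is none). A sequence $(\alpha_n)$ of rectifiable loops in $X$ is absolutely non-divisible if there is a constant $M>0$ such that $P(\alpha_n,|\alpha_n|/M)$ and $|\alpha_n|$ both tend to $+\infty$, and the ratios $|\alpha_{n+1}|/|\alpha_n|$ are bounded. For an ultrafilter $\omega$ on $\mathbb N$, a sequence $d=(d_n)$ of positive real numbers with $\lim^\omega d_n=\infty$, and a sequence $e=(e_n)$ of points of $X$, the asymptotic cone $\operatorname{Con}^\omega(X,e,d)$ is the set of sequences $x=(x_n)$ in $X$ for which $\operatorname{dist}(x_n,e_n)/d_n$ is bounded $\omega$-almost surely, with the distance $\operatorname{dist}(x,y)=\lim^\omega \operatorname{dist}(x_n,y_n)/d_n$, modulo the relation $\operatorname{dist}(x,y)=0$. Suppose that there is a sequence of loops in $X$ which is absolutely non-divisible. Then, for all such $\omega$, $d$ and $e$, the fundamental group of $\operatorname{Con}^\omega(X,e,d)$ (at every base point) is uncountable, and $\operatorname{Con}^\omega(X,e,d)$ is not semilocally simply connected at any of its points: for every point $p$ and every neighbourhood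 $U$ of $p$, the homomorphism $\pi_1(U,p)\to\pi_1(\operatorname{Con}^\omega(X,e,d),p)$ induced by inclusion is non-trivial. -/

import Mathlib

open Set Filter Topology
open scoped NNReal ENNReal

/-! ### Geodesic and homogeneous metric spaces -/

/-- Any two points `x`, `y` are joined by an isometric embedding of `[0, dist x y]`. -/
def IsGeodesicMetricSpace (X : Type*) [MetricSpace X] : Prop :=
  ∀ x y : X, ∃ c : ℝ → X, c 0 = x ∧ c (dist x y) = y ∧
    ∀ s ∈ Icc 0 (dist x y), ∀ t ∈ Icc 0 (dist x y), dist (c s) (c t) = |s - t|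

/-- The isometry group acts transitively. -/
def IsHomogeneousMetricSpace (X : Type*) [MetricSpace X] : Prop :=
  ∀ x y : X, ∃ f : X ≃ᵢ X, f x = y

/-! ### Asymptotic cones -/

/-- An `ω`-divergent sequence of positive real numbers. -/
structure ScalingSequence (ω : Ultrafilter ℕ) where
  toFun : ℕ → ℝ
  pos : ∀ n, 0 < toFun n
  diverges : Tendsto toFun (ω : Filter ℕ) atTop

/-- The sequences in `X` at finite rescaled distance from the observation sequence `e`. -/
def ConeSequence {X : Type*} [MetricSpace X] {ω : Ultrafilter ℕ} (d : ScalingSequence ω)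
    (e : ℕ → X) : Type _ :=
  {x : ℕ → X // ∃ M : ℝ, ∀ᶠ n in (ω : Filter ℕ), dist (x n) (e n) / d.toFun n < M}

namespace ConeSequence

variable {X : Type*} [MetricSpace X] {ω : Ultrafilter ℕ} {d : ScalingSequence ω} {e : ℕ → X}

theorem exists_tendsto (x y : ConeSequence d e) :
    ∃ l : ℝ, Tendsto (fun n => dist (x.1 n) (y.1 n) / d.toFun n) (ω : Filter ℕ) (𝓝 l) := by
  obtain ⟨A, hA⟩ := x.2
  obtain ⟨B, hB⟩ := y.2
  have hmem : Icc (0 : ℝ) (A + B) ∈ ω.map (fun n => dist (x.1 n) (y.1 n) / d.toFun n) := by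
    change ∀ᶠ n in (ω : Filter ℕ), dist (x.1 n) (y.1 n) / d.toFun n ∈ Icc (0 : ℝ) (A + B)
    filter_upwards [hA, hB] with n h1 h2
    refine ⟨div_nonneg dist_nonneg (d.pos n).le, ?_⟩
    have h3 : dist (x.1 n) (y.1 n) / d.toFun n ≤
        (dist (x.1 n) (e n) + dist (y.1 n) (e n)) / d.toFun n :=
      div_le_div_of_nonneg_right (dist_triangle_right _ _ _) (d.pos n).le
    rw [add_div] at h3
    linarith
  obtain ⟨l, -, hl⟩ := isCompact_Icc.ultrafilter_le_nhds' _ hmem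
  exact ⟨l, hl⟩

/-- The distance of two sequences is the `ω`-limit of `dist (x n) (y n) / d n`; this limit exists by
`exists_tendsto`. -/
noncomputable instance : Dist (ConeSequence d e) where
  dist x y := limUnder (ω : Filter ℕ) fun n => dist (x.1 n) (y.1 n) / d.toFun n

theorem tendsto_dist (x y : ConeSequence d e) :
    Tendsto (fun n => dist (x.1 n) (y.1 n) / d.toFun n) (ω : Filter ℕ) (𝓝 (dist x y)) :=
  tendsto_nhds_limUnder (exists_tendsto x y)

noncomputable instance : PseudoMetricSpace (ConeSequence d e) where
  dist_self x := by
    refine tendsto_nhds_unique (tendsto_dist x x) ?_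
    simp
  dist_comm x y := by
    refine tendsto_nhds_unique (tendsto_dist x y) ?_
    simpa only [dist_comm] using tendsto_dist y x
  dist_triangle x y z := by
    refine le_of_tendsto_of_tendsto' (tendsto_dist x z)
      ((tendsto_dist x y).add (tendsto_dist y z)) fun n => ?_
    rw [← add_div]
    exact div_le_div_of_nonneg_right (dist_triangle _ _ _) (d.pos n).le

end ConeSequence

/-- The asymptotic cone `Con^ω(X, e, d)`: the quotient of the space of sequences at finite distance
from `e` by the relation `dist x y = 0`. -/
abbrev AsymptoticCone {X : Type*} [MetricSpace X] {ω : Ultrafilter ℕ} (d : ScalingSequence ω)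
    (e : ℕ → X) : Type _ :=
  SeparationQuotient (ConeSequence d e)

/-! ### Semilocal simple connectedness -/

/-- Some neighbourhood `U` of `x` has trivial image `π₁(U, x) → π₁(Y, x)`. -/
def SemilocallySimplyConnectedAt {Y : Type*} [TopologicalSpace Y] (x : Y) : Prop :=
  ∃ (U : Set Y) (hU : U ∈ 𝓝 x),
    ∀ g : FundamentalGroup U ⟨x, mem_of_mem_nhds hU⟩,
      FundamentalGroup.map (⟨Subtype.val, continuous_subtype_val⟩ : C(U, Y))
        ⟨x, mem_of_mem_nhds hU⟩ g = 1

/-! ### Partitions of the unit disc -/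

/-- A partition of the closed unit disc of the plane `ℂ` into finitely many closed topological
discs. -/
structure DiscPartition where
  numCells : ℕ
  cell : Fin numCells → Set ℂ
  isDisc : ∀ i, Nonempty (cell i ≃ₜ Metric.closedBall (0 : ℂ) 1)
  iUnion_cell : ⋃ i, cell i = Metric.closedBall (0 : ℂ) 1
  disjoint_interior : ∀ i j, i ≠ j → Disjoint (interior (cell i)) (interior (cell j))
  inter_eq : ∀ i j, i ≠ j → cell i ∩ cell j = frontier (cell i) ∩ frontier (cell j)

namespace DiscPartition

/-- The union of the boundary circles of the discs. -/
def graph (P : DiscPartition) : Set ℂ := ⋃ i, frontier (P.cell i)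

/-- The points of the graph with no open neighbourhood in the graph that is homeomorphic to an
interval. -/
def vertices (P : DiscPartition) : Set ℂ :=
  {p | p ∈ P.graph ∧ ∀ U : Set ℂ, IsOpen U → p ∈ U →
    ¬ ∃ I : Set ℝ, I.OrdConnected ∧ Nonempty (↥(U ∩ P.graph) ≃ₜ ↥I)}

/-- The open edges on the boundary circle of the `i`-th disc: the connected components of that
circle minus the vertices. (For the partition into a single disc there is no vertex, and the
only edge is the whole circle.) -/
def edges (P : DiscPartition) (i : Fin P.numCells) : Set (Set ℂ) :=
  {E | ∃ x ∈ frontier (P.cell i) \ P.vertices,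
    E = connectedComponentIn (frontier (P.cell i) \ P.vertices) x}

end DiscPartition

/-! ### Loops and their partitions -/

section Loops

variable {X : Type*} [MetricSpace X]

/-- The arc length of a loop. -/
noncomputable def loopLength (γ : C(Circle, X)) : ℝ≥0∞ :=
  eVariationOn (fun t : ℝ => γ (Circle.exp t)) (Icc 0 (2 * Real.pi))

/-- The arc length of the part of the loop `γ` over an arc `E` of the unit circle: the supremum
over all intervals that `t ↦ exp (i t)` maps injectively into `E`. -/
noncomputable def arcLengthOver (γ : C(Circle, X)) (E : Set ℂ) : ℝ≥0∞ :=
  ⨆ (I : Set ℝ) (_ : I.OrdConnected) (_ : InjOn Circle.exp I)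
    (_ : ∀ t ∈ I, (Circle.exp t : ℂ) ∈ E), eVariationOn (fun t : ℝ => γ (Circle.exp t)) I

/-- A partition of the loop `γ`: a partition of the disc with a map from its vertices to `X` that
agrees with `γ` at the vertices on the unit circle. -/
structure LoopPartition (γ : C(Circle, X)) where
  disc : DiscPartition
  toFun : disc.vertices → X
  eq_on_circle : ∀ (z : Circle) (hz : (z : ℂ) ∈ disc.vertices), toFun ⟨z, hz⟩ = γ z

namespace LoopPartition

variable {γ : C(Circle, X)}

open Classical in
/-- The length of an edge: an edge in the unit circle is mapped to the corresponding subpath of `γ`,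
every other edge to a geodesic segment between the images of its two end points, whose
length is the distance of these images, that is, the diameter of the set formed by them. -/
noncomputable def edgeLength (Q : LoopPartition γ) (E : Set ℂ) : ℝ≥0∞ :=
  if E ⊆ Metric.sphere (0 : ℂ) 1 then arcLengthOver γ E
  else Metric.ediam (Q.toFun '' {v | (v : ℂ) ∈ closure E})

/-- The length of the loop to which the boundary of the `i`-th disc is mapped. -/
noncomputable def pieceLength (Q : LoopPartition γ) (i : Fin Q.disc.numCells) : ℝ≥0∞ :=
  ∑' E : Q.disc.edges i, Q.edgeLength E

/-- The maximal length of a piece. -/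
noncomputable def mesh (Q : LoopPartition γ) : ℝ≥0∞ := ⨆ i, Q.pieceLength i

end LoopPartition

/-- `P(γ, δ)`: the minimal number of pieces in a partition of `γ` of mesh less than `δ`, and `⊤` if
there is none. -/
noncomputable def partitionNumber (γ : C(Circle, X)) (δ : ℝ≥0∞) : ℕ∞ :=
  ⨅ (Q : LoopPartition γ) (_ : Q.mesh < δ), (Q.disc.numCells : ℕ∞)

/-- A sequence of rectifiable loops is absolutely non-divisible if their lengths tend to infinity
with bounded ratios of consecutive lengths, and `P(αₙ, |αₙ| / M)` tends to infinity for some `M`. -/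
def AbsolutelyNonDivisible (α : ℕ → C(Circle, X)) : Prop :=
  (∀ n, loopLength (α n) ≠ ⊤) ∧
  (∃ M : ℝ, 0 < M ∧
    Tendsto (fun n => partitionNumber (α n) (loopLength (α n) / ENNReal.ofReal M)) atTop (𝓝 ⊤)) ∧
  Tendsto (fun n => loopLength (α n)) atTop (𝓝 ⊤) ∧
  ∃ C : ℝ≥0, ∀ n, loopLength (α (n + 1)) / loopLength (α n) ≤ C

end Loops

/-! ### Exponential images of rectangles -/

namespace Complex

/-! The core is that every point of the cone carries, at every scale `r`, an essential loop: a `C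
r`-Lipschitz loop that is not homotopic to any loop with Lipschitz constant below `r / M`
(`exists_essential_loop`, `HasEssentialLoopsAt`). Bounded ratios of lengths allow a choice of `α (m
n)` of length comparable to `r * d n`; homogeneity moves its base point to the `n`-th term of a
sequence representing the given point; the rescaled constant-speed loops have a Lipschitz limit in
the cone.

Suppose this limit were homotopic to a short loop. A homotopy is uniformly continuous, so a fine
grid on its domain has small cells. Lifting the grid points to `X` turns it into a polar grid on the
disc whose outer circle is `α (m n)`, whose sectors have small perimeter, and whose central disc is
bounded by a polygon close to the short loop. All pieces are shorter than `|α (m n)| / M`, while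
their number does not depend on `n`; this contradicts the divergence of the partition numbers
(`not_homotopic_of_tendsto_partitionNumber`). Most of the work is
`CircleSubdivision.partitionNumber_le`, which determines the vertices of the polar grid, and enough
about its edges to bound all lengths, from the topological definitions.

Comparison with the constant loop at small scales refutes semilocal simple connectedness. For
uncountability, take essential loops at scales `q ^ k` and form the infinite concatenation of each
subfamily. If two choices first differ at `k` and the results are homotopic, cancelling the common
beginning makes the `k`-th loop homotopic to a product of two tails, which is too short when `q` is
small. So binary sequences inject into the fundamental group. -/

theorem mem_exp_image_reProdIm {A B : Set ℝ} {z : ℂ} :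
    z ∈ exp '' (A ×ℂ B) ↔ ∃ x ∈ A, ∃ y ∈ B, exp (x + y * I) = z := by
  constructor
  · rintro ⟨w, ⟨h1, h2⟩, rfl⟩
    exact ⟨w.re, h1, w.im, h2, by rw [re_add_im]⟩
  · rintro ⟨x, hx, y, hy, rfl⟩
    exact ⟨_, ⟨by simpa using hx, by simpa using hy⟩, rfl⟩

theorem exp_polar_eq_iff {x y x' y' : ℝ} :
    exp (x + y * I) = exp (x' + y' * I) ↔ x = x' ∧ ∃ m : ℤ, y = y' + 2 * Real.pi * m := by
  rw [exp_eq_exp_iff_exists_int]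
  constructor
  · rintro ⟨m, hm⟩
    have h1 := congrArg re hm
    have h2 := congrArg im hm
    simp at h1 h2
    exact ⟨h1, m, by rw [h2]; ring⟩
  · rintro ⟨rfl, m, rfl⟩
    exact ⟨m, by push_cast; ring⟩

theorem norm_exp_polar (x y : ℝ) : ‖exp (x + y * I)‖ = Real.exp x := by
  rw [norm_exp]; simp

theorem exists_exp_polar {z : ℂ} (hz : z ≠ 0) :
    exp (Real.log ‖z‖ + arg z * I) = z := by
  have h := exp_log hz
  rwa [← re_add_im (log z), log_re, log_im] at h

theorem injOn_exp_reProdIm {A : Set ℝ} {c d : ℝ} (hcd : d - c < 2 * Real.pi) :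
    InjOn exp (A ×ℂ Icc c d) := by
  rintro w ⟨-, hw⟩ w' ⟨-, hw'⟩ h
  rw [← re_add_im w, ← re_add_im w', exp_polar_eq_iff] at h
  obtain ⟨h1, m, hm⟩ := h
  simp only [mem_preimage, mem_Icc] at hw hw'
  have hm0 : m = 0 := by
    have hpi := Real.pi_pos
    have h3 : (m : ℝ) < 1 := by by_contra! hc; nlinarith
    have h4 : (-1 : ℝ) < m := by by_contra! hc; nlinarith
    have h3' : m < 1 := by exact_mod_cast h3
    have h4' : -1 < m := by exact_mod_cast h4
    omega
  subst hm0
  exact Complex.ext h1 (by simpa using hm)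

section Rectangle

variable {a b c d : ℝ}

theorem isCompact_exp_rectangle : IsCompact (exp '' (Icc a b ×ℂ Icc c d)) :=
  (isCompact_Icc.reProdIm isCompact_Icc).image continuous_exp

theorem interior_exp_rectangle (hcd : d - c < 2 * Real.pi) :
    interior (exp '' (Icc a b ×ℂ Icc c d)) = exp '' (Ioo a b ×ℂ Ioo c d) := by
  have hint : interior (Icc a b ×ℂ Icc c d) = Ioo a b ×ℂ Ioo c d := by
    rw [interior_reProdIm, interior_Icc, interior_Icc]
  apply Subset.antisymm
  · intro z hz
    obtain ⟨w, hw, rfl⟩ := interior_subset hz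
    refine ⟨w, ?_, rfl⟩
    rw [← hint, mem_interior]
    -- For an angle in this strip, only the zero multiple of `2π` can shift it into `[c, d]`; hence
    -- this open set lies inside the rectangle.
    refine ⟨exp ⁻¹' interior (exp '' (Icc a b ×ℂ Icc c d)) ∩
      (univ ×ℂ Ioo (d - 2 * Real.pi) (c + 2 * Real.pi)), ?_, ?_, hz, ?_⟩
    · rintro v ⟨hv, -, hv2⟩
      obtain ⟨u, hu, huv⟩ := interior_subset hv
      have key := huv
      rw [← re_add_im u, ← re_add_im v, exp_polar_eq_iff] at key
      obtain ⟨h1, m, hm⟩ := key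
      obtain ⟨hu1, hu2⟩ := hu
      simp only [mem_preimage, mem_Icc, mem_Ioo] at hu2 hv2
      have hm0 : m = 0 := by
        have hpi := Real.pi_pos
        have h3 : (m : ℝ) < 1 := by by_contra! hc; nlinarith
        have h4 : (-1 : ℝ) < m := by by_contra! hc; nlinarith
        have h3' : m < 1 := by exact_mod_cast h3
        have h4' : -1 < m := by exact_mod_cast h4
        omega
      subst hm0
      have : u = v := Complex.ext h1 (by simpa using hm)
      subst this
      exact ⟨hu1, hu2⟩
    · exact (isOpen_interior.preimage continuous_exp).inter (isOpen_univ.reProdIm isOpen_Ioo)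
    · obtain ⟨-, hw2⟩ := hw
      simp only [mem_preimage, mem_Icc] at hw2
      exact ⟨mem_univ _, by simp only [mem_preimage, mem_Ioo]; constructor <;> linarith⟩
  · rw [← hint]
    refine interior_maximal (image_mono interior_subset) (isOpenMap_exp _ isOpen_interior)

theorem closure_interior_exp_rectangle (hab : a < b) (hc : c < d) (hcd : d - c < 2 * Real.pi) :
    closure (interior (exp '' (Icc a b ×ℂ Icc c d))) = exp '' (Icc a b ×ℂ Icc c d) := by
  apply Subset.antisymm
  · exact closure_minimal interior_subset isCompact_exp_rectangle.isClosed
  · rw [interior_exp_rectangle hcd]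
    have : Icc a b ×ℂ Icc c d = closure (Ioo a b ×ℂ Ioo c d) := by
      rw [closure_reProdIm, closure_Ioo hab.ne, closure_Ioo hc.ne]
    rw [this]
    exact image_closure_subset_closure_image continuous_exp

theorem mem_frontier_exp_rectangle (hcd : d - c < 2 * Real.pi) {z : ℂ} :
    z ∈ frontier (exp '' (Icc a b ×ℂ Icc c d)) ↔
      ∃ x ∈ Icc a b, ∃ y ∈ Icc c d, (x = a ∨ x = b ∨ y = c ∨ y = d) ∧ exp (x + y * I) = z := by
  rw [isCompact_exp_rectangle.isClosed.frontier_eq, interior_exp_rectangle hcd]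
  constructor
  · rintro ⟨h1, h2⟩
    rw [mem_exp_image_reProdIm] at h1 h2
    obtain ⟨x, hx, y, hy, rfl⟩ := h1
    refine ⟨x, hx, y, hy, ?_, rfl⟩
    by_contra! hne
    exact h2 ⟨x, ⟨lt_of_le_of_ne hx.1 hne.1.symm, lt_of_le_of_ne hx.2 hne.2.1⟩, y,
      ⟨lt_of_le_of_ne hy.1 hne.2.2.1.symm, lt_of_le_of_ne hy.2 hne.2.2.2⟩, rfl⟩
  · rintro ⟨x, hx, y, hy, h, rfl⟩
    refine ⟨mem_exp_image_reProdIm.2 ⟨x, hx, y, hy, rfl⟩, ?_⟩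
    rintro ⟨w, ⟨hw1, hw2⟩, hw⟩
    have := injOn_exp_reProdIm (A := Icc a b) hcd ⟨Ioo_subset_Icc_self hw1, Ioo_subset_Icc_self hw2⟩
      (⟨by simpa using hx, by simpa using hy⟩ : (x + y * I : ℂ) ∈ Icc a b ×ℂ Icc c d) hw
    subst this
    simp at hw1 hw2
    rcases h with h | h | h | h <;> simp [h] at hw1 hw2

end Rectangle

theorem nonempty_homeomorph_closedBall {s : Set ℂ} (hs : Convex ℝ s) (hc : IsCompact s)
    (hi : (interior s).Nonempty) : Nonempty (s ≃ₜ Metric.closedBall (0 : ℂ) 1) := by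
  obtain ⟨h, -, h2, -⟩ := exists_homeomorph_image_interior_closure_frontier_eq_unitBall hs hi
    hc.isBounded
  rw [hc.isClosed.closure_eq] at h2
  exact ⟨(h.image s).trans (Homeomorph.setCongr h2)⟩

theorem nonempty_homeomorph_image {s : Set ℂ} (hs : IsCompact s) {f : ℂ → ℂ}
    (hf : Continuous f) (hi : InjOn f s) : Nonempty (s ≃ₜ f '' s) := by
  have : CompactSpace s := isCompact_iff_compactSpace.1 hs
  have hc : Continuous (Equiv.Set.imageOfInjOn f s hi) :=
    Continuous.subtype_mk (hf.comp continuous_subtype_val) _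
  exact ⟨hc.homeoOfEquivCompactToT2⟩

theorem nonempty_exp_rectangle_homeomorph {a b c d : ℝ} (hab : a < b) (hc : c < d)
    (hcd : d - c < 2 * Real.pi) :
    Nonempty (exp '' (Icc a b ×ℂ Icc c d) ≃ₜ Metric.closedBall (0 : ℂ) 1) := by
  have hK : IsCompact (Icc a b ×ℂ Icc c d) := isCompact_Icc.reProdIm isCompact_Icc
  obtain ⟨h1⟩ := nonempty_homeomorph_image hK continuous_exp (injOn_exp_reProdIm hcd)
  obtain ⟨h2⟩ := nonempty_homeomorph_closedBall (s := Icc a b ×ℂ Icc c d)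
    (((convex_Icc a b).linear_preimage reLm).inter ((convex_Icc c d).linear_preimage imLm)) hK (by
      rw [interior_reProdIm, interior_Icc, interior_Icc]
      exact ⟨⟨(a + b) / 2, (c + d) / 2⟩, by constructor <;> simp <;> constructor <;> linarith⟩)
  exact ⟨h1.symm.trans h2⟩

end Complex

/-! ### The polar grid -/

/-- A `2π`-periodic subdivision of the line of angles with `N ≥ 2` points per period. -/
structure CircleSubdivision (N : ℕ) where
  t : ℤ → ℝ
  strictMono : StrictMono t
  period : ∀ k, t (k + N) = t k + 2 * Real.pi
  two_le : 2 ≤ N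

namespace CircleSubdivision

variable {N : ℕ} (S : CircleSubdivision N)

theorem t_add_mul (k m : ℤ) : S.t (k + N * m) = S.t k + 2 * Real.pi * m := by
  induction m using Int.induction_on with
  | zero => simp
  | succ i ih =>
    have := S.period (k + N * i)
    rw [ih] at this
    rw [mul_add, mul_one, ← add_assoc, this]; push_cast; ring
  | pred i ih =>
    have := S.period (k + N * (-i - 1))
    rw [show k + (N : ℤ) * (-i - 1) + N = k + N * (-i) by ring, ih] at this
    push_cast at this ⊢; linarith

theorem lt_succ (k : ℤ) : S.t k < S.t (k + 1) := S.strictMono (by omega)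

/-- This is where `2 ≤ N` matters: `exp` is injective on the rectangle of a sector only if the
sector does not close up. -/
theorem width_lt (k : ℤ) : S.t (k + 1) - S.t k < 2 * Real.pi := by
  have h1 := S.period k
  have h2 := S.two_le
  have h3 : S.t (k + 1) < S.t (k + N) := S.strictMono (by omega)
  linarith

theorem exists_mem_Ico (y : ℝ) : ∃ k, y ∈ Ico (S.t k) (S.t (k + 1)) := by
  have hpi := Real.pi_pos
  have hN : (0 : ℤ) < N := by have := S.two_le; omega
  obtain ⟨a, ha⟩ := exists_int_lt ((y - S.t 0) / (2 * Real.pi))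
  obtain ⟨b, hb⟩ := exists_int_gt ((y - S.t 0) / (2 * Real.pi))
  rw [lt_div_iff₀ (by positivity)] at ha
  rw [div_lt_iff₀ (by positivity)] at hb
  have hA := S.t_add_mul 0 a
  have hB := S.t_add_mul 0 b
  obtain ⟨k, hk, hmax⟩ := Int.exists_greatest_of_bdd (P := fun k => S.t k ≤ y)
    ⟨0 + N * b, fun z hz => by
      by_contra! hc
      have := S.strictMono hc
      linarith⟩ ⟨0 + N * a, by linarith⟩
  refine ⟨k, hk, ?_⟩
  by_contra! hc
  have := hmax _ hc
  omega

theorem index_eq {k l : ℤ} {y : ℝ} (h1 : y ∈ Ico (S.t k) (S.t (k + 1)))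
    (h2 : y ∈ Ico (S.t l) (S.t (l + 1))) : k = l := by
  have a := S.strictMono.lt_iff_lt.1 (h1.1.trans_lt h2.2)
  have b := S.strictMono.lt_iff_lt.1 (h2.1.trans_lt h1.2)
  omega

theorem t_notMem_Ioo (k l : ℤ) : S.t l ∉ Ioo (S.t k) (S.t (k + 1)) := by
  rintro ⟨h1, h2⟩
  have a := S.strictMono.lt_iff_lt.1 h1
  have b := S.strictMono.lt_iff_lt.1 h2
  omega

/-- The representative of the index `k` modulo `N`. -/
theorem exists_fin (S : CircleSubdivision N) (k : ℤ) : ∃ (l : Fin N) (m : ℤ), k = (l : ℕ) + N * m := by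
  have hN : (0 : ℤ) < N := by have := S.two_le; omega
  have h1 := Int.emod_nonneg k hN.ne'
  have h2 := Int.emod_lt_of_pos k hN
  refine ⟨⟨(k % N).toNat, by omega⟩, k / N, ?_⟩
  have := Int.emod_add_mul_ediv k N
  simp only
  rw [Int.toNat_of_nonneg h1]
  exact this.symm

theorem fin_eq {k l : Fin N} {m : ℤ} (h : ((k : ℕ) : ℤ) = (l : ℕ) + N * m) : k = l := by
  have hk := k.2
  have hl := l.2
  have : m = 0 := by
    have h3 : m < 1 := by by_contra! hc; nlinarith
    have h4 : -1 < m := by by_contra! hc; nlinarith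
    omega
  subst this
  ext; omega

variable (J : ℕ)

/-- The cells of the polar grid with `J` rings: the central disc and `J * N` annular sectors. -/
def cell : Option (Fin J × Fin N) → Set ℂ
  | none => Metric.closedBall 0 (Real.exp (-J))
  | some (j, k) => Complex.exp '' (Icc ((j : ℕ) - J : ℝ) ((j : ℕ) + 1 - J) ×ℂ
      Icc (S.t (k : ℕ)) (S.t ((k : ℕ) + 1)))

variable {J}

theorem isClosed_cell (c : Option (Fin J × Fin N)) : IsClosed (S.cell J c) := by
  rcases c with _ | ⟨j, k⟩
  · exact Metric.isClosed_closedBall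
  · exact Complex.isCompact_exp_rectangle.isClosed

theorem nonempty_cell_homeomorph (c : Option (Fin J × Fin N)) :
    Nonempty (S.cell J c ≃ₜ Metric.closedBall (0 : ℂ) 1) := by
  rcases c with _ | ⟨j, k⟩
  · refine Complex.nonempty_homeomorph_closedBall (convex_closedBall _ _)
      (isCompact_closedBall _ _) ?_
    rw [cell, interior_closedBall _ (Real.exp_pos _).ne']
    exact ⟨0, by simp [Real.exp_pos]⟩
  · exact Complex.nonempty_exp_rectangle_homeomorph (by linarith) (S.lt_succ _) (S.width_lt _)

/-- Regularity of the cells is what upgrades disjointness of interiors to the condition that cells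
meet only along their boundaries. -/
theorem closure_interior_cell (c : Option (Fin J × Fin N)) :
    closure (interior (S.cell J c)) = S.cell J c := by
  rcases c with _ | ⟨j, k⟩
  · simp only [cell]
    rw [interior_closedBall _ (Real.exp_pos _).ne', closure_ball _ (Real.exp_pos _).ne']
  · exact Complex.closure_interior_exp_rectangle (by linarith) (S.lt_succ _) (S.width_lt _)

theorem disjoint_interior_cell {c c' : Option (Fin J × Fin N)} (hne : c ≠ c') :
    Disjoint (interior (S.cell J c)) (interior (S.cell J c')) := by
  have hcenter : ∀ j k, Disjoint (interior (S.cell J none)) (interior (S.cell J (some (j, k)))) := by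
    intro j k
    simp only [cell]
    rw [interior_closedBall _ (Real.exp_pos _).ne', Complex.interior_exp_rectangle (S.width_lt _),
      Set.disjoint_left]
    intro z hz hz'
    rw [Complex.mem_exp_image_reProdIm] at hz'
    obtain ⟨x, hx, y, -, rfl⟩ := hz'
    rw [mem_ball_zero_iff, Complex.norm_exp_polar, Real.exp_lt_exp] at hz
    have := hx.1
    have : (0 : ℝ) ≤ (j : ℕ) := Nat.cast_nonneg _
    linarith
  rcases c with _ | ⟨j, k⟩ <;> rcases c' with _ | ⟨j', k'⟩
  · exact absurd rfl hne
  · exact hcenter _ _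
  · exact (hcenter _ _).symm
  · simp only [cell]
    rw [Complex.interior_exp_rectangle (S.width_lt _), Complex.interior_exp_rectangle (S.width_lt _),
      Set.disjoint_left]
    intro z hz hz'
    rw [Complex.mem_exp_image_reProdIm] at hz hz'
    obtain ⟨x, hx, y, hy, rfl⟩ := hz
    obtain ⟨x', hx', y', hy', h⟩ := hz'
    obtain ⟨rfl, m, rfl⟩ := Complex.exp_polar_eq_iff.1 h
    apply hne
    have hj : j = j' := by
      have a : ((j : ℕ) : ℝ) < (j' : ℕ) + 1 := by linarith [hx.1, hx'.2]
      have b : ((j' : ℕ) : ℝ) < (j : ℕ) + 1 := by linarith [hx'.1, hx.2]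
      have a' : (j : ℕ) < (j' : ℕ) + 1 := by exact_mod_cast a
      have b' : (j' : ℕ) < (j : ℕ) + 1 := by exact_mod_cast b
      ext; omega
    have hk : k' = k := by
      refine fin_eq (m := m) (S.index_eq (Ioo_subset_Ico_self hy') ?_)
      rw [show (((k : ℕ) : ℤ) + N * m + 1) = ((k : ℕ) : ℤ) + 1 + N * m by ring, S.t_add_mul,
        S.t_add_mul]
      exact ⟨by linarith [hy.1], by linarith [hy.2]⟩
    rw [hj, hk]

theorem iUnion_cell : ⋃ c, S.cell J c = Metric.closedBall (0 : ℂ) 1 := by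
  apply Subset.antisymm
  · refine iUnion_subset ?_
    rintro (_ | ⟨j, k⟩)
    · exact Metric.closedBall_subset_closedBall (by simp)
    · intro z hz
      simp only [cell, Complex.mem_exp_image_reProdIm] at hz
      obtain ⟨x, hx, y, -, rfl⟩ := hz
      rw [mem_closedBall_zero_iff, Complex.norm_exp_polar, Real.exp_le_one_iff]
      have h : ((j : ℕ) : ℝ) + 1 ≤ J := by exact_mod_cast j.2
      linarith [hx.2]
  · intro z hz
    rw [mem_iUnion]
    by_cases hz0 : ‖z‖ ≤ Real.exp (-J)
    · exact ⟨none, by simpa [cell] using hz0⟩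
    push Not at hz0
    have hpos : 0 < ‖z‖ := (Real.exp_pos _).trans hz0
    have hzne : z ≠ 0 := norm_pos_iff.1 hpos
    have hx0 : -(J : ℝ) < Real.log ‖z‖ := (Real.lt_log_iff_exp_lt hpos).2 hz0
    have hx1 : Real.log ‖z‖ ≤ 0 := Real.log_nonpos hpos.le (by simpa using hz)
    have hzp := Complex.exists_exp_polar hzne
    set x := Real.log ‖z‖
    obtain ⟨k, hk⟩ := S.exists_mem_Ico (Complex.arg z)
    obtain ⟨l, m, rfl⟩ := S.exists_fin k
    rw [show (((l : ℕ) : ℤ) + N * m + 1) = ((l : ℕ) : ℤ) + 1 + N * m by ring, S.t_add_mul,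
        S.t_add_mul] at hk
    -- The ring index is the ceiling minus one rather than the floor, so that `x = 0` falls into the
    -- last ring.
    obtain ⟨j, hj⟩ : ∃ j : Fin J, x ∈ Icc ((j : ℕ) - J : ℝ) ((j : ℕ) + 1 - J) := by
      have hc : 0 < x + J := by linarith
      have h1 := Nat.lt_ceil.1 (Nat.sub_one_lt (Nat.ceil_pos.2 hc).ne')
      have h2 := Nat.le_ceil (x + J)
      have h3 : ⌈x + J⌉₊ ≤ J := Nat.ceil_le.2 (by linarith)
      have h4 := Nat.ceil_pos.2 hc
      refine ⟨⟨⌈x + J⌉₊ - 1, by omega⟩, ?_, ?_⟩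
      · simp only; linarith
      · simp only; push_cast [Nat.cast_sub (show 1 ≤ ⌈x + J⌉₊ from h4)]; linarith
    refine ⟨some (j, l), ?_⟩
    simp only [cell, Complex.mem_exp_image_reProdIm]
    refine ⟨x, hj, Complex.arg z - 2 * Real.pi * m, ⟨by linarith [hk.1], by linarith [hk.2]⟩, ?_⟩
    refine Eq.trans ?_ hzp
    rw [Complex.exp_polar_eq_iff]
    exact ⟨rfl, -m, by push_cast; ring⟩

variable (J) in
/-- The polar grid as a partition of the unit disc. -/
noncomputable def partition : DiscPartition where
  numCells := Fintype.card (Option (Fin J × Fin N))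
  cell i := S.cell J ((Fintype.equivFin _).symm i)
  isDisc i := S.nonempty_cell_homeomorph _
  iUnion_cell := by
    rw [← S.iUnion_cell (J := J)]
    exact (Fintype.equivFin _).symm.surjective.iUnion_comp _
  disjoint_interior i j h := S.disjoint_interior_cell fun h' => h ((Equiv.injective _) h')
  inter_eq i j h := by
    -- A common point interior to one cell is a limit of interior points of the other, so the two
    -- interiors would meet.
    have key : ∀ c c' : Option (Fin J × Fin N), c ≠ c' → ∀ z ∈ S.cell J c, z ∈ S.cell J c' →
        z ∈ frontier (S.cell J c) := by
      intro c c' hne z hz hz'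
      rw [(S.isClosed_cell c).frontier_eq]
      refine ⟨hz, fun hzi => ?_⟩
      rw [← S.closure_interior_cell c', mem_closure_iff] at hz'
      obtain ⟨w, hw, hw'⟩ := hz' _ isOpen_interior hzi
      exact (S.disjoint_interior_cell hne).le_bot ⟨hw, hw'⟩
    have hne := fun h' => h ((Fintype.equivFin (Option (Fin J × Fin N))).symm.injective h')
    apply Subset.antisymm
    · exact fun z hz => ⟨key _ _ hne z hz.1 hz.2, key _ _ (Ne.symm hne) z hz.2 hz.1⟩
    · exact inter_subset_inter (S.isClosed_cell _).frontier_subset (S.isClosed_cell _).frontier_subset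

theorem frontier_center :
    frontier (S.cell J none) = Metric.sphere (0 : ℂ) (Real.exp (-J)) :=
  frontier_closedBall _ (Real.exp_pos _).ne'

theorem mem_sphere_exp {r : ℝ} {z : ℂ} :
    z ∈ Metric.sphere (0 : ℂ) (Real.exp r) ↔ ∃ y : ℝ, Complex.exp (r + y * Complex.I) = z := by
  constructor
  · intro h
    rw [mem_sphere_zero_iff_norm] at h
    have hz : z ≠ 0 := norm_pos_iff.1 (h ▸ Real.exp_pos r)
    refine ⟨Complex.arg z, ?_⟩
    have := Complex.exists_exp_polar hz
    rwa [h, Real.log_exp] at this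
  · rintro ⟨y, rfl⟩
    rw [mem_sphere_zero_iff_norm, Complex.norm_exp_polar]

theorem t_add_two_pi (k m : ℤ) : S.t k + 2 * Real.pi * m = S.t (k + N * m) := (S.t_add_mul k m).symm

theorem exp_mem_graph_iff {x y : ℝ} (hJ : 0 < J) :
    Complex.exp (x + y * Complex.I) ∈ (S.partition J).graph ↔
      (∃ j : ℕ, j ≤ J ∧ x = j - J) ∨ (x ∈ Icc (-J : ℝ) 0 ∧ ∃ k, y = S.t k) := by
  have hg : (S.partition J).graph = ⋃ c, frontier (S.cell J c) :=
    (Fintype.equivFin (Option (Fin J × Fin N))).symm.surjective.iUnion_comp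
      fun c => frontier (S.cell J c)
  rw [hg, mem_iUnion]
  constructor
  · rintro ⟨_ | ⟨j, k⟩, h⟩
    · rw [frontier_center, mem_sphere_zero_iff_norm, Complex.norm_exp_polar,
        Real.exp_injective.eq_iff] at h
      exact Or.inl ⟨0, by simp, by simpa using h⟩
    · obtain ⟨x', hx', y', hy', h1, h2⟩ := (Complex.mem_frontier_exp_rectangle (S.width_lt _)).1 h
      obtain ⟨rfl, m, rfl⟩ := Complex.exp_polar_eq_iff.1 h2
      have hj : ((j : ℕ) : ℝ) + 1 ≤ J := by exact_mod_cast j.2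
      have hj0 : (0 : ℝ) ≤ (j : ℕ) := Nat.cast_nonneg _
      rcases h1 with h1 | h1 | h1 | h1
      · exact Or.inl ⟨j, j.2.le, h1⟩
      · exact Or.inl ⟨j + 1, j.2, by push_cast; exact h1⟩
      · refine Or.inr ⟨⟨by linarith [hx'.1], by linarith [hx'.2]⟩, (k : ℕ) + N * (-m), ?_⟩
        rw [S.t_add_mul]; push_cast; linarith
      · refine Or.inr ⟨⟨by linarith [hx'.1], by linarith [hx'.2]⟩, ((k : ℕ) + 1) + N * (-m), ?_⟩
        rw [S.t_add_mul]; push_cast; linarith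
  · have aux : ∀ j : Fin J, ∀ k : ℤ, ∀ y, x ∈ Icc ((j : ℕ) - J : ℝ) ((j : ℕ) + 1 - J) →
        y ∈ Icc (S.t k) (S.t (k + 1)) →
        (x = (j : ℕ) - J ∨ x = (j : ℕ) + 1 - J ∨ y = S.t k ∨ y = S.t (k + 1)) →
        ∃ c, Complex.exp (x + y * Complex.I) ∈ frontier (S.cell J c) := by
      intro j k y hx hy h
      obtain ⟨l, m, rfl⟩ := S.exists_fin k
      rw [show (((l : ℕ) : ℤ) + N * m + 1) = ((l : ℕ) : ℤ) + 1 + N * m by ring, S.t_add_mul,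
        S.t_add_mul] at hy h
      refine ⟨some (j, l), (Complex.mem_frontier_exp_rectangle (S.width_lt _)).2
        ⟨x, hx, y - 2 * Real.pi * m, ⟨by linarith [hy.1], by linarith [hy.2]⟩, ?_, ?_⟩⟩
      · rcases h with h | h | h | h
        · exact Or.inl h
        · exact Or.inr (Or.inl h)
        · exact Or.inr (Or.inr (Or.inl (by linarith)))
        · exact Or.inr (Or.inr (Or.inr (by linarith)))
      · rw [Complex.exp_polar_eq_iff]
        exact ⟨rfl, -m, by push_cast; ring⟩
    rintro (⟨j, hj, hx⟩ | ⟨hx, k, rfl⟩)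
    · obtain ⟨k, hk⟩ := S.exists_mem_Ico y
      rcases Nat.lt_or_ge j J with h | h
      · exact aux ⟨j, h⟩ k y ⟨hx.ge, by simp only; linarith⟩ (Ico_subset_Icc_self hk) (Or.inl hx)
      · have hjJ : j = J := le_antisymm hj h
        have : ((J - 1 : ℕ) : ℝ) = J - 1 := by rw [Nat.cast_sub hJ]; simp
        refine aux ⟨J - 1, by omega⟩ k y ?_ (Ico_subset_Icc_self hk) (Or.inr (Or.inl ?_))
        · simp only [this, hx, hjJ]; constructor <;> linarith
        · simp only [this, hx, hjJ]; ring
    · have hc : 0 ≤ x + J := by linarith [hx.1]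
      obtain ⟨j, hj⟩ : ∃ j : Fin J, x ∈ Icc ((j : ℕ) - J : ℝ) ((j : ℕ) + 1 - J) := by
        rcases hx.2.lt_or_eq with h | h
        · have h1 := Nat.floor_le hc
          have h2 := Nat.lt_floor_add_one (x + J)
          have h3 : ⌊x + J⌋₊ < J := (Nat.floor_lt hc).2 (by linarith)
          exact ⟨⟨_, h3⟩, by simp only; linarith, by simp only; linarith⟩
        · have : ((J - 1 : ℕ) : ℝ) = J - 1 := by rw [Nat.cast_sub hJ]; simp
          refine ⟨⟨J - 1, by omega⟩, ?_⟩
          simp only [this, h]; constructor <;> linarith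
      exact aux j k _ hj ⟨le_rfl, (S.lt_succ k).le⟩ (Or.inr (Or.inr (Or.inl rfl)))

end CircleSubdivision

/-! ### Vertices and edges of the polar grid -/

namespace DiscPartition

/-- A point of the graph from which three disjoint curves in the graph emanate is a vertex. -/
theorem mem_vertices_of_three_curves {P : DiscPartition} {p : ℂ} (hp : p ∈ P.graph)
    (c : Fin 3 → ℝ → ℂ) (hc : ∀ i, Continuous (c i)) (h0 : ∀ i, c i 0 = p)
    (hg : ∀ i, ∀ s ∈ Ioo (0 : ℝ) 1, c i s ∈ P.graph) (hne : ∀ i, ∀ s ∈ Ioo (0 : ℝ) 1, c i s ≠ p)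
    (hd : ∀ i j, i ≠ j → ∀ s ∈ Ioo (0 : ℝ) 1, ∀ s' ∈ Ioo (0 : ℝ) 1, c i s ≠ c j s') :
    p ∈ P.vertices := by
  refine ⟨hp, fun U hU hpU => ?_⟩
  rintro ⟨I, -, ⟨φ⟩⟩
  have hev : ∀ᶠ s in 𝓝 (0 : ℝ), ∀ i, c i s ∈ U := by
    rw [eventually_all]
    intro i
    exact (hc i).continuousAt.eventually (by rw [h0 i]; exact hU.mem_nhds hpU)
  obtain ⟨ε, hε, hball⟩ := Metric.eventually_nhds_iff.1 hev
  set η := min (ε / 2) (1 / 2)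
  have hη0 : 0 < η := by positivity
  have hη1 : η < 1 := (min_le_right _ _).trans_lt (by norm_num)
  have hmem : ∀ i, ∀ s : Icc 0 η, c i s ∈ U ∩ P.graph := by
    rintro i ⟨s, hs0, hs1⟩
    refine ⟨hball ?_ i, ?_⟩
    · rw [Real.dist_eq, sub_zero, abs_of_nonneg hs0]
      exact hs1.trans_lt ((min_le_left _ _).trans_lt (by linarith))
    · rcases hs0.eq_or_lt with h | h
      · simp only [← h, h0]; exact hp
      · exact hg i s ⟨h, by linarith⟩
  let g : Fin 3 → Icc 0 η → ℝ := fun i s => φ ⟨c i s, hmem i s⟩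
  have hgc : ∀ i, Continuous (g i) := fun i => continuous_subtype_val.comp
    (φ.continuous.comp (Continuous.subtype_mk ((hc i).comp continuous_subtype_val) _))
  have hginj : ∀ i j s s', g i s = g j s' → c i s = c j s' := by
    intro i j s s' h
    exact congrArg Subtype.val (φ.injective (Subtype.ext h))
  let z : Icc 0 η := ⟨0, le_rfl, hη0.le⟩
  let e : Icc 0 η := ⟨η, hη0.le, le_rfl⟩
  have hz : ∀ i j, g i z = g j z := by
    intro i j
    simp only [g, z, h0]
  have hpos : ∀ i s, g i s ≠ g i z → (s : ℝ) ∈ Ioo (0 : ℝ) 1 := by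
    rintro i ⟨s, hs0, hs1⟩ h
    refine ⟨hs0.lt_of_ne ?_, hs1.trans_lt hη1⟩
    rintro rfl
    exact h rfl
  have hene : ∀ i, g i e ≠ g i z := by
    intro i h
    refine hne i η ⟨hη0, hη1⟩ ?_
    have := hginj _ _ _ _ h
    simpa only [z, e, h0] using this
  have : PreconnectedSpace (Icc 0 η) := Subtype.preconnectedSpace isPreconnected_Icc
  have key : ∀ i j, i ≠ j → ∀ v, v ≠ g i z → v ∈ range (g i) → v ∈ range (g j) → False := by
    rintro i j hij v hv ⟨s, hs⟩ ⟨s', hs'⟩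
    refine hd i j hij s (hpos i s (hs ▸ hv)) s' (hpos j s' ?_) (hginj _ _ _ _ (hs.trans hs'.symm))
    rw [hs', hz j i]; exact hv
  -- In the interval the three curves start at one point, and a point of a line has only two sides.
  -- Two curves leave on the same side, and by the intermediate value theorem they share a value,
  -- contrary to disjointness.
  obtain ⟨i, j, hij, hs⟩ := Fintype.exists_ne_map_eq_of_card_lt
    (fun i : Fin 3 => decide (g i z < g i e)) (by simp)
  simp only [decide_eq_decide] at hs
  rcases lt_or_gt_of_ne (hene i) with h | h
  · have h' : g j e < g j z := by
      rcases lt_or_gt_of_ne (hene j) with h' | h'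
      · exact h'
      · exact absurd (hs.2 h') (not_lt.2 h.le)
    have hzz := hz i j
    refine key i j hij (max (g i e) (g j e)) (max_lt h (hzz ▸ h')).ne ?_ ?_
    · exact intermediate_value_univ e z (hgc i) ⟨le_max_left _ _, (max_lt h (hzz ▸ h')).le⟩
    · exact intermediate_value_univ e z (hgc j) ⟨le_max_right _ _, hzz ▸ (max_lt h (hzz ▸ h')).le⟩
  · have h' : g j z < g j e := hs.1 h
    have hzz := hz i j
    have h'' := lt_min h (hzz ▸ h')
    refine key i j hij (min (g i e) (g j e)) h''.ne' ?_ ?_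
    · exact intermediate_value_univ z e (hgc i) ⟨h''.le, min_le_left _ _⟩
    · exact intermediate_value_univ z e (hgc j) ⟨hzz ▸ h''.le, min_le_right _ _⟩

/-- A point near which the graph is an open arc is not a vertex. -/
theorem notMem_vertices_of_arc {P : DiscPartition} {p : ℂ} {U : Set ℂ} (hU : IsOpen U) (hpU : p ∈ U)
    {f : ℝ → ℂ} (hf : Continuous f) {a b : ℝ} (hi : InjOn f (Icc a b))
    (h : U ∩ P.graph = f '' Ioo a b) : p ∉ P.vertices := by
  rintro ⟨-, hv⟩
  refine hv U hU hpU ⟨Ioo a b, ordConnected_Ioo, ?_⟩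
  have h1 : IsEmbedding (fun x : Icc a b => f x) :=
    (Continuous.isClosedEmbedding (hf.comp continuous_subtype_val) fun x y hxy =>
      Subtype.ext (hi x.2 y.2 hxy)).isEmbedding
  have h2 : IsEmbedding (fun x : Ioo a b => f x) :=
    h1.comp (IsEmbedding.inclusion (Ioo_subset_Icc_self (a := a) (b := b)))
  have h3 : range (fun x : Ioo a b => f x) = U ∩ P.graph := by
    rw [h]; exact (image_eq_range _ _).symm
  exact ⟨(Homeomorph.setCongr h3.symm).trans h2.toHomeomorph.symm⟩

end DiscPartition

/-- The components of a set cut by points `V` into finitely many arcs. -/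
theorem exists_connectedComponentIn_eq {ι : Type*} [Finite ι] {F V : Set ℂ} {A : ι → Set ℂ}
    (hcov : F ⊆ V ∪ ⋃ i, A i) (hA : ∀ i, A i ⊆ F \ V) (hpre : ∀ i, IsPreconnected (A i))
    (hcl : ∀ i, closure (A i) ⊆ A i ∪ V) (hdis : ∀ i j, A i = A j ∨ Disjoint (A i) (A j))
    {x : ℂ} (hx : x ∈ F \ V) : ∃ i, connectedComponentIn (F \ V) x = A i := by
  obtain ⟨i, hi⟩ : ∃ i, x ∈ A i := by
    rcases hcov hx.1 with h | h
    · exact absurd h hx.2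
    · simpa using h
  refine ⟨i, Subset.antisymm ?_ ((hpre i).subset_connectedComponentIn hi (hA i))⟩
  -- Finiteness makes `G` closed. The closures of distinct arcs meet only in `V`, so the component
  -- is covered by two closed sets that are disjoint on it, and it must lie in one.
  set G : Set ℂ := ⋃ j ∈ {j | A j ≠ A i}, closure (A j)
  have hG : IsClosed G := (Set.toFinite _).isClosed_biUnion fun _ _ => isClosed_closure
  have hsub : connectedComponentIn (F \ V) x ⊆ closure (A i) ∪ G := by
    intro y hy
    have hy' := connectedComponentIn_subset _ _ hy
    rcases hcov hy'.1 with h | h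
    · exact absurd h hy'.2
    · obtain ⟨j, hj⟩ := mem_iUnion.1 h
      by_cases hji : A j = A i
      · exact Or.inl (subset_closure (hji ▸ hj))
      · exact Or.inr (mem_biUnion (show j ∈ {j | A j ≠ A i} from hji) (subset_closure hj))
  have hdisj : connectedComponentIn (F \ V) x ∩ (closure (A i) ∩ G) = ∅ := by
    rw [eq_empty_iff_forall_notMem]
    rintro y ⟨hy, hy1, hy2⟩
    have hyV := (connectedComponentIn_subset _ _ hy).2
    obtain ⟨j, hj, hyj⟩ := mem_iUnion₂.1 hy2
    rcases hcl i hy1 with h1 | h1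
    · rcases hcl j hyj with h2 | h2
      · rcases hdis j i with h3 | h3
        · exact hj h3
        · exact h3.le_bot ⟨h2, h1⟩
      · exact hyV h2
    · exact hyV h1
  have hsub' : connectedComponentIn (F \ V) x ⊆ closure (A i) := by
    rcases isPreconnected_iff_subset_of_disjoint_closed.1 isPreconnected_connectedComponentIn _ _
      isClosed_closure hG hsub hdisj with h | h
    · exact h
    · have hxc := mem_connectedComponentIn hx
      have : x ∈ connectedComponentIn (F \ V) x ∩ (closure (A i) ∩ G) :=
        ⟨hxc, subset_closure hi, h hxc⟩
      rw [hdisj] at this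
      exact this.elim
  intro y hy
  rcases hcl i (hsub' hy) with h | h
  · exact h
  · exact absurd h (connectedComponentIn_subset _ _ hy).2

namespace CircleSubdivision

variable {N : ℕ} (S : CircleSubdivision N) (J : ℕ)

/-- The open arc of the `j`-th circle between two consecutive angles. -/
def circleArc (j : ℕ) (k : ℤ) : Set ℂ :=
  (fun y : ℝ => Complex.exp (((j - J : ℝ) : ℂ) + y * Complex.I)) '' Ioo (S.t k) (S.t (k + 1))

/-- The open radial segment between two consecutive circles. -/
def radialArc (j : ℕ) (k : ℤ) : Set ℂ :=
  (fun x : ℝ => Complex.exp ((x : ℂ) + (S.t k : ℝ) * Complex.I)) '' Ioo (j - J : ℝ) (j + 1 - J)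

variable {J}

theorem nat_sub_notMem_Ioo (i j : ℕ) : (i - J : ℝ) ∉ Ioo (j - J : ℝ) (j + 1 - J) := by
  rintro ⟨h1, h2⟩
  have a : (j : ℝ) < i := by linarith
  have b : (i : ℝ) < j + 1 := by linarith
  have a' : j < i := by exact_mod_cast a
  have b' : i < j + 1 := by exact_mod_cast b
  omega

/-- Away from the crossings of circles and rays, a small log-polar rectangle meets the graph in a
single arc. At a crossing, two arcs of the circle and one radial segment emanate. -/
theorem exp_mem_vertices_iff (hJ : 0 < J) {x y : ℝ} :
    Complex.exp (x + y * Complex.I) ∈ (S.partition J).vertices ↔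
      (∃ j : ℕ, j ≤ J ∧ x = j - J) ∧ ∃ k, y = S.t k := by
  constructor
  · intro h
    by_contra hcon
    rcases (S.exp_mem_graph_iff hJ).1 h.1 with ⟨j, hj, rfl⟩ | ⟨hx, k, rfl⟩
    · have hy : ∀ k, y ≠ S.t k := fun k hk => hcon ⟨⟨j, hj, rfl⟩, k, hk⟩
      obtain ⟨k, hk⟩ := S.exists_mem_Ico y
      have hk' : y ∈ Ioo (S.t k) (S.t (k + 1)) := ⟨hk.1.lt_of_ne (hy k).symm, hk.2⟩
      refine DiscPartition.notMem_vertices_of_arc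
        (U := Complex.exp '' (Ioo (j - J - 1 : ℝ) (j - J + 1) ×ℂ Ioo (S.t k) (S.t (k + 1))))
        (f := fun y : ℝ => Complex.exp (((j - J : ℝ) : ℂ) + y * Complex.I)) (a := S.t k)
        (b := S.t (k + 1)) (Complex.isOpenMap_exp _ (isOpen_Ioo.reProdIm isOpen_Ioo)) ?_
        (by fun_prop) ?_ ?_ h
      · exact Complex.mem_exp_image_reProdIm.2 ⟨_, ⟨by linarith, by linarith⟩, y, hk', rfl⟩
      · intro u hu v hv huv
        have := Complex.injOn_exp_reProdIm (A := univ) (S.width_lt k) ⟨mem_univ _, by simpa using hu⟩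
          ⟨mem_univ _, by simpa using hv⟩ huv
        simpa using congrArg Complex.im this
      · ext z
        constructor
        · rintro ⟨hz, hzg⟩
          obtain ⟨x', hx', y', hy', rfl⟩ := Complex.mem_exp_image_reProdIm.1 hz
          rcases (S.exp_mem_graph_iff hJ).1 hzg with ⟨j', hj', rfl⟩ | ⟨-, k', rfl⟩
          · have a : (j : ℝ) < j' + 1 := by linarith [hx'.1]
            have b : (j' : ℝ) < j + 1 := by linarith [hx'.2]
            have a' : j < j' + 1 := by exact_mod_cast a
            have b' : j' < j + 1 := by exact_mod_cast b
            obtain rfl : j = j' := by omega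
            exact ⟨y', hy', rfl⟩
          · exact absurd hy' (S.t_notMem_Ioo _ _)
        · rintro ⟨y', hy', rfl⟩
          exact ⟨Complex.mem_exp_image_reProdIm.2 ⟨_, ⟨by linarith, by linarith⟩, y', hy', rfl⟩,
            (S.exp_mem_graph_iff hJ).2 (Or.inl ⟨j, hj, rfl⟩)⟩
    · have hxne : ∀ j : ℕ, j ≤ J → x ≠ j - J := fun j hj hxj => hcon ⟨⟨j, hj, hxj⟩, k, rfl⟩
      have hc : 0 ≤ x + J := by linarith [hx.1]
      have hx0 : x < 0 := hx.2.lt_of_ne (by simpa using hxne J le_rfl)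
      obtain ⟨j, hjJ, hj⟩ : ∃ j : ℕ, j < J ∧ x ∈ Ioo (j - J : ℝ) (j + 1 - J) := by
        have h1 := Nat.floor_le hc
        have h2 := Nat.lt_floor_add_one (x + J)
        have h3 : ⌊x + J⌋₊ < J := (Nat.floor_lt hc).2 (by linarith)
        refine ⟨_, h3, lt_of_le_of_ne (by linarith) (hxne _ h3.le).symm, by linarith⟩
      have hjJ' : (j : ℝ) + 1 ≤ J := by exact_mod_cast hjJ
      have hj0 : (0 : ℝ) ≤ j := Nat.cast_nonneg _
      refine DiscPartition.notMem_vertices_of_arc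
        (U := Complex.exp '' (Ioo (j - J : ℝ) (j + 1 - J) ×ℂ Ioo (S.t (k - 1)) (S.t (k + 1))))
        (f := fun x : ℝ => Complex.exp ((x : ℂ) + (S.t k : ℝ) * Complex.I)) (a := j - J)
        (b := j + 1 - J) (Complex.isOpenMap_exp _ (isOpen_Ioo.reProdIm isOpen_Ioo)) ?_
        (by fun_prop) ?_ ?_ h
      · exact Complex.mem_exp_image_reProdIm.2 ⟨_, hj, _, ⟨S.strictMono (by omega), S.lt_succ k⟩, rfl⟩
      · intro u _ v _ huv
        exact (Complex.exp_polar_eq_iff.1 huv).1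
      · ext z
        constructor
        · rintro ⟨hz, hzg⟩
          obtain ⟨x', hx', y', hy', rfl⟩ := Complex.mem_exp_image_reProdIm.1 hz
          rcases (S.exp_mem_graph_iff hJ).1 hzg with ⟨j', hj', rfl⟩ | ⟨-, k', rfl⟩
          · exact absurd hx' (nat_sub_notMem_Ioo _ _)
          · have a := S.strictMono.lt_iff_lt.1 hy'.1
            have b := S.strictMono.lt_iff_lt.1 hy'.2
            obtain rfl : k' = k := by omega
            exact ⟨x', hx', rfl⟩
        · rintro ⟨x', hx', rfl⟩
          exact ⟨Complex.mem_exp_image_reProdIm.2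
            ⟨_, hx', _, ⟨S.strictMono (by omega), S.lt_succ k⟩, rfl⟩,
            (S.exp_mem_graph_iff hJ).2 (Or.inr ⟨⟨by linarith [hx'.1], by linarith [hx'.2]⟩, k, rfl⟩)⟩
  · rintro ⟨⟨j, hj, rfl⟩, k, rfl⟩
    have hjJ : (j : ℝ) ≤ J := by exact_mod_cast hj
    have hj0 : (0 : ℝ) ≤ j := Nat.cast_nonneg _
    -- The radial curve runs outwards, except on the unit circle, where it runs inwards; on the
    -- innermost circle only the outward direction stays in the graph.
    obtain ⟨σ, hσ, hσ'⟩ : ∃ σ : ℝ, σ ≠ 0 ∧ ∀ s ∈ Ioo (0 : ℝ) 1, (j - J + σ * s : ℝ) ∈ Icc (-J : ℝ) 0 := by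
      rcases hj.lt_or_eq with h | h
      · have : (j : ℝ) + 1 ≤ J := by exact_mod_cast h
        exact ⟨1, one_ne_zero, fun s hs => ⟨by linarith [hs.1], by linarith [hs.2]⟩⟩
      · have : (1 : ℝ) ≤ J := by exact_mod_cast hJ
        exact ⟨-1, by norm_num, fun s hs => ⟨by rw [h]; linarith [hs.2], by linarith [hs.1]⟩⟩
    have hpi : 3 < Real.pi := Real.pi_gt_three
    -- The two circular curves use parameters below `1`, so their angles differ by less than `2 <
    -- 2π` and they cannot meet again.
    have hint : ∀ u v : ℝ, u ∈ Ioo (0 : ℝ) 2 → ∀ m : ℤ, v + u ≠ v + 2 * Real.pi * m := by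
      intro u v hu m h
      have h1 : u = 2 * Real.pi * m := by linarith
      have h2 : (0 : ℝ) < m := by by_contra! hc; nlinarith [hu.1]
      have h3 : (m : ℝ) < 1 := by by_contra! hc; nlinarith [hu.2]
      have h2' : 0 < m := by exact_mod_cast h2
      have h3' : m < 1 := by exact_mod_cast h3
      omega
    let c : Fin 3 → ℝ → ℂ := ![fun s => Complex.exp ((j - J : ℝ) + (S.t k + s : ℝ) * Complex.I),
      fun s => Complex.exp ((j - J : ℝ) + (S.t k - s : ℝ) * Complex.I),
      fun s => Complex.exp ((j - J + σ * s : ℝ) + (S.t k : ℝ) * Complex.I)]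
    have h01 : ∀ s ∈ Ioo (0 : ℝ) 1, ∀ s' ∈ Ioo (0 : ℝ) 1, c 0 s ≠ c 1 s' := by
      intro s hs s' hs' h
      obtain ⟨-, m, hm⟩ := Complex.exp_polar_eq_iff.1 h
      exact hint (s + s') (S.t k - s') ⟨by linarith [hs.1, hs'.1], by linarith [hs.2, hs'.2]⟩ m
        (by linarith)
    have h02 : ∀ s ∈ Ioo (0 : ℝ) 1, ∀ s' ∈ Ioo (0 : ℝ) 1, c 0 s ≠ c 2 s' := by
      intro s hs s' hs' h
      have h1 := (Complex.exp_polar_eq_iff.1 h).1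
      exact mul_ne_zero hσ hs'.1.ne' (by linarith)
    have h12 : ∀ s ∈ Ioo (0 : ℝ) 1, ∀ s' ∈ Ioo (0 : ℝ) 1, c 1 s ≠ c 2 s' := by
      intro s hs s' hs' h
      have h1 := (Complex.exp_polar_eq_iff.1 h).1
      exact mul_ne_zero hσ hs'.1.ne' (by linarith)
    refine DiscPartition.mem_vertices_of_three_curves
      ((S.exp_mem_graph_iff hJ).2 (Or.inl ⟨j, hj, rfl⟩)) c ?_ ?_ ?_ ?_ ?_
    · intro i
      fin_cases i
      · change Continuous fun s : ℝ => Complex.exp ((j - J : ℝ) + (S.t k + s : ℝ) * Complex.I)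
        fun_prop
      · change Continuous fun s : ℝ => Complex.exp ((j - J : ℝ) + (S.t k - s : ℝ) * Complex.I)
        fun_prop
      · change Continuous fun s : ℝ => Complex.exp ((j - J + σ * s : ℝ) + (S.t k : ℝ) * Complex.I)
        fun_prop
    · intro i
      fin_cases i <;> simp [c]
    · intro i s hs
      fin_cases i
      · exact (S.exp_mem_graph_iff hJ).2 (Or.inl ⟨j, hj, rfl⟩)
      · exact (S.exp_mem_graph_iff hJ).2 (Or.inl ⟨j, hj, rfl⟩)
      · exact (S.exp_mem_graph_iff hJ).2 (Or.inr ⟨hσ' s hs, k, rfl⟩)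
    · intro i s hs h
      fin_cases i
      · obtain ⟨-, m, hm⟩ := Complex.exp_polar_eq_iff.1 h
        exact hint s (S.t k) ⟨hs.1, by linarith [hs.2]⟩ m hm
      · obtain ⟨-, m, hm⟩ := Complex.exp_polar_eq_iff.1 h
        exact hint s (S.t k) ⟨hs.1, by linarith [hs.2]⟩ (-m) (by push_cast; linarith)
      · have h1 := (Complex.exp_polar_eq_iff.1 h).1
        exact mul_ne_zero hσ hs.1.ne' (by linarith)
    · intro i i' hne s hs s' hs' h
      fin_cases i <;> fin_cases i'
      · exact hne rfl
      · exact h01 s hs s' hs' h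
      · exact h02 s hs s' hs' h
      · exact h01 s' hs' s hs h.symm
      · exact hne rfl
      · exact h12 s hs s' hs' h
      · exact h02 s' hs' s hs h.symm
      · exact h12 s' hs' s hs h.symm
      · exact hne rfl

end CircleSubdivision

/-! ### The arcs of the polar grid and the edges of its cells -/

namespace CircleSubdivision

variable {N : ℕ} (S : CircleSubdivision N) {J : ℕ}

theorem circleArc_add_mul (j : ℕ) (k m : ℤ) : S.circleArc J j (k + N * m) = S.circleArc J j k := by
  have h : ∀ k m : ℤ, S.circleArc J j (k + N * m) ⊆ S.circleArc J j k := by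
    rintro k m _ ⟨y, hy, rfl⟩
    rw [show k + N * m + 1 = k + 1 + N * m by ring, S.t_add_mul, S.t_add_mul] at hy
    refine ⟨y - 2 * Real.pi * m, ⟨by linarith [hy.1], by linarith [hy.2]⟩, ?_⟩
    exact Complex.exp_polar_eq_iff.2 ⟨rfl, -m, by push_cast; ring⟩
  refine (h k m).antisymm ?_
  have := h (k + N * m) (-m)
  rwa [show k + N * m + N * -m = k by ring] at this

theorem radialArc_add_mul (j : ℕ) (k m : ℤ) : S.radialArc J j (k + N * m) = S.radialArc J j k := by
  refine image_congr fun x _ => ?_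
  rw [Complex.exp_polar_eq_iff, S.t_add_mul]
  exact ⟨rfl, m, rfl⟩

theorem eq_add_mul_of_Ioo {k k' m : ℤ} {y : ℝ} (h : y + 2 * Real.pi * m ∈ Ioo (S.t k) (S.t (k + 1)))
    (h' : y ∈ Ioo (S.t k') (S.t (k' + 1))) : k = k' + N * m := by
  refine S.index_eq (Ioo_subset_Ico_self h) ?_
  rw [show k' + N * m + 1 = k' + 1 + N * m by ring, S.t_add_mul, S.t_add_mul]
  exact ⟨by linarith [h'.1], by linarith [h'.2]⟩

theorem circleArc_eq_or_disjoint (j j' : ℕ) (k k' : ℤ) :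
    S.circleArc J j k = S.circleArc J j' k' ∨ Disjoint (S.circleArc J j k) (S.circleArc J j' k') := by
  refine or_iff_not_imp_right.2 fun h => ?_
  obtain ⟨_, ⟨y, hy, rfl⟩, y', hy', h⟩ := not_disjoint_iff.1 h
  obtain ⟨h1, m, h2⟩ := Complex.exp_polar_eq_iff.1 h.symm
  have h3 : (j : ℝ) = j' := by linarith
  obtain rfl : j = j' := by exact_mod_cast h3
  rw [h2] at hy
  rw [S.eq_add_mul_of_Ioo hy hy', circleArc_add_mul]

theorem disjoint_circleArc_radialArc (j j' : ℕ) (k k' : ℤ) :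
    Disjoint (S.circleArc J j k) (S.radialArc J j' k') := by
  rw [Set.disjoint_left]
  rintro _ ⟨y, -, rfl⟩ ⟨x, hx, h⟩
  obtain ⟨rfl, -⟩ := Complex.exp_polar_eq_iff.1 h
  exact nat_sub_notMem_Ioo _ _ hx

theorem radialArc_eq_or_disjoint (j j' : ℕ) (k k' : ℤ) :
    S.radialArc J j k = S.radialArc J j' k' ∨ Disjoint (S.radialArc J j k) (S.radialArc J j' k') := by
  refine or_iff_not_imp_right.2 fun h => ?_
  obtain ⟨_, ⟨x, hx, rfl⟩, x', hx', h⟩ := not_disjoint_iff.1 h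
  obtain ⟨rfl, m, h2⟩ := Complex.exp_polar_eq_iff.1 h.symm
  have a : (j : ℝ) < j' + 1 := by linarith [hx.1, hx'.2]
  have b : (j' : ℝ) < j + 1 := by linarith [hx'.1, hx.2]
  have a' : j < j' + 1 := by exact_mod_cast a
  have b' : j' < j + 1 := by exact_mod_cast b
  obtain rfl : j = j' := by omega
  rw [S.t_add_two_pi] at h2
  rw [S.strictMono.injective h2, radialArc_add_mul]

theorem isPreconnected_circleArc (j : ℕ) (k : ℤ) : IsPreconnected (S.circleArc J j k) :=
  isPreconnected_Ioo.image _ (by fun_prop)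

theorem isPreconnected_radialArc (j : ℕ) (k : ℤ) : IsPreconnected (S.radialArc J j k) :=
  isPreconnected_Ioo.image _ (by fun_prop)

theorem closure_circleArc_subset (j : ℕ) (k : ℤ) : closure (S.circleArc J j k) ⊆
    (fun y : ℝ => Complex.exp (((j - J : ℝ) : ℂ) + y * Complex.I)) ''
      Icc (S.t k) (S.t (k + 1)) :=
  closure_minimal (image_mono Ioo_subset_Icc_self)
    (isCompact_Icc.image (by fun_prop)).isClosed

theorem closure_radialArc_subset (j : ℕ) (k : ℤ) : closure (S.radialArc J j k) ⊆
    (fun x : ℝ => Complex.exp ((x : ℂ) + (S.t k : ℝ) * Complex.I)) ''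
      Icc (j - J : ℝ) (j + 1 - J) :=
  closure_minimal (image_mono Ioo_subset_Icc_self)
    (isCompact_Icc.image (by fun_prop)).isClosed

theorem disjoint_circleArc_vertices (hJ : 0 < J) (j : ℕ) (k : ℤ) :
    Disjoint (S.circleArc J j k) (S.partition J).vertices := by
  rw [Set.disjoint_left]
  rintro _ ⟨y, hy, rfl⟩ hv
  obtain ⟨-, l, rfl⟩ := (S.exp_mem_vertices_iff hJ).1 hv
  exact S.t_notMem_Ioo _ _ hy

theorem disjoint_radialArc_vertices (hJ : 0 < J) (j : ℕ) (k : ℤ) :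
    Disjoint (S.radialArc J j k) (S.partition J).vertices := by
  rw [Set.disjoint_left]
  rintro _ ⟨x, hx, rfl⟩ hv
  obtain ⟨⟨i, -, rfl⟩, -⟩ := (S.exp_mem_vertices_iff hJ).1 hv
  exact nat_sub_notMem_Ioo _ _ hx

theorem closure_circleArc_subset_union (hJ : 0 < J) {j : ℕ} (hj : j ≤ J) (k : ℤ) :
    closure (S.circleArc J j k) ⊆ S.circleArc J j k ∪ (S.partition J).vertices := by
  intro z hz
  obtain ⟨y, hy, rfl⟩ := S.closure_circleArc_subset j k hz
  by_cases h : y ∈ Ioo (S.t k) (S.t (k + 1))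
  · exact Or.inl ⟨y, h, rfl⟩
  · refine Or.inr ((S.exp_mem_vertices_iff hJ).2 ⟨⟨j, hj, rfl⟩, ?_⟩)
    by_contra! hc
    exact h ⟨hy.1.lt_of_ne (hc k).symm, hy.2.lt_of_ne (hc _)⟩

theorem closure_radialArc_subset_union (hJ : 0 < J) {j : ℕ} (hj : j < J) (k : ℤ) :
    closure (S.radialArc J j k) ⊆ S.radialArc J j k ∪ (S.partition J).vertices := by
  intro z hz
  obtain ⟨x, hx, rfl⟩ := S.closure_radialArc_subset j k hz
  by_cases h : x ∈ Ioo (j - J : ℝ) (j + 1 - J)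
  · exact Or.inl ⟨x, h, rfl⟩
  · refine Or.inr ((S.exp_mem_vertices_iff hJ).2 ⟨?_, k, rfl⟩)
    by_contra! hc
    exact h ⟨hx.1.lt_of_ne (hc j hj.le).symm,
      hx.2.lt_of_ne (by have := hc (j + 1) hj; push_cast at this; exact this)⟩

theorem edge_of_center (hJ : 0 < J) {x : ℂ}
    (hx : x ∈ frontier (S.cell J none) \ (S.partition J).vertices) :
    ∃ k : Fin N, connectedComponentIn (frontier (S.cell J none) \ (S.partition J).vertices) x =
      S.circleArc J 0 (k : ℕ) := by
  refine exists_connectedComponentIn_eq ?_ ?_ (fun k => S.isPreconnected_circleArc 0 _)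
    (fun k => S.closure_circleArc_subset_union hJ hJ.le _)
    (fun k k' => S.circleArc_eq_or_disjoint 0 0 _ _) hx
  · intro z hz
    rw [frontier_center, mem_sphere_exp] at hz
    obtain ⟨y, rfl⟩ := hz
    obtain ⟨k, hk⟩ := S.exists_mem_Ico y
    obtain ⟨l, m, rfl⟩ := S.exists_fin k
    rcases hk.1.eq_or_lt with h | h
    · exact Or.inl ((S.exp_mem_vertices_iff hJ).2 ⟨⟨0, hJ.le, by simp⟩, _, h.symm⟩)
    · refine Or.inr (mem_iUnion.2 ⟨l, ?_⟩)
      rw [← S.circleArc_add_mul 0 _ m]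
      exact ⟨y, ⟨h, hk.2⟩, by simp⟩
  · intro k z hz
    refine ⟨?_, fun hv => (S.disjoint_circleArc_vertices hJ 0 k).le_bot ⟨hz, hv⟩⟩
    obtain ⟨y, -, rfl⟩ := hz
    rw [frontier_center, mem_sphere_exp]
    exact ⟨y, by simp⟩

/-- The four sides cover the frontier up to vertices, and their closures add only vertices, so
`exists_connectedComponentIn_eq` applies. Only an upper bound for lengths is wanted, so it suffices
that every edge is in the list. -/
theorem edge_of_sector (hJ : 0 < J) (j : Fin J) (k : Fin N) {x : ℂ}
    (hx : x ∈ frontier (S.cell J (some (j, k))) \ (S.partition J).vertices) :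
    ∃ i : Fin 4,
      connectedComponentIn (frontier (S.cell J (some (j, k))) \ (S.partition J).vertices) x =
      ![S.circleArc J j (k : ℕ), S.circleArc J (j + 1) (k : ℕ), S.radialArc J j (k : ℕ),
        S.radialArc J j ((k : ℕ) + 1)] i := by
  have hk1 := S.lt_succ (k : ℕ)
  refine exists_connectedComponentIn_eq ?_ ?_ ?_ ?_ ?_ hx
  · intro z hz
    obtain ⟨x, hx, y, hy, h, rfl⟩ := (Complex.mem_frontier_exp_rectangle (S.width_lt _)).1 hz
    by_cases hv : Complex.exp (x + y * Complex.I) ∈ (S.partition J).vertices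
    · exact Or.inl hv
    refine Or.inr (mem_iUnion.2 ?_)
    rw [S.exp_mem_vertices_iff hJ] at hv
    have hyo : ∀ i : ℕ, i ≤ J → x = i - J → y ∈ Ioo (S.t (k : ℕ)) (S.t ((k : ℕ) + 1)) := by
      intro i hi hxi
      exact ⟨hy.1.lt_of_ne fun h => hv ⟨⟨i, hi, hxi⟩, _, h.symm⟩,
        hy.2.lt_of_ne fun h => hv ⟨⟨i, hi, hxi⟩, _, h⟩⟩
    have hxo : ∀ l, y = S.t l → x ∈ Ioo ((j : ℕ) - J : ℝ) ((j : ℕ) + 1 - J) := by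
      intro l hl
      exact ⟨hx.1.lt_of_ne fun h => hv ⟨⟨j, j.2.le, h.symm⟩, l, hl⟩,
        hx.2.lt_of_ne fun h => hv ⟨⟨j + 1, j.2, by push_cast; exact h⟩, l, hl⟩⟩
    rcases h with h | h | h | h
    · exact ⟨0, y, hyo _ j.2.le h, by simp [h]⟩
    · exact ⟨1, y, hyo ((j : ℕ) + 1) j.2 (by push_cast; exact h), by simp [h]⟩
    · exact ⟨2, x, hxo _ h, by simp [h]⟩
    · exact ⟨3, x, hxo _ h, by simp [h]⟩
  · intro i
    refine subset_sdiff.2 ⟨?_, ?_⟩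
    · intro z hz
      refine (Complex.mem_frontier_exp_rectangle (S.width_lt _)).2 ?_
      fin_cases i
      · obtain ⟨y, hy, rfl⟩ := hz
        exact ⟨_, ⟨le_rfl, by linarith⟩, y, Ioo_subset_Icc_self hy, Or.inl rfl, rfl⟩
      · obtain ⟨y, hy, rfl⟩ := hz
        exact ⟨_, ⟨by push_cast; linarith, by push_cast; exact le_rfl⟩, y, Ioo_subset_Icc_self hy,
          Or.inr (Or.inl (by push_cast; rfl)), rfl⟩
      · obtain ⟨x, hx, rfl⟩ := hz
        exact ⟨x, Ioo_subset_Icc_self hx, _, ⟨le_rfl, hk1.le⟩, Or.inr (Or.inr (Or.inl rfl)), rfl⟩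
      · obtain ⟨x, hx, rfl⟩ := hz
        exact ⟨x, Ioo_subset_Icc_self hx, _, ⟨hk1.le, le_rfl⟩, Or.inr (Or.inr (Or.inr rfl)), rfl⟩
    · fin_cases i
      · exact S.disjoint_circleArc_vertices hJ _ _
      · exact S.disjoint_circleArc_vertices hJ _ _
      · exact S.disjoint_radialArc_vertices hJ _ _
      · exact S.disjoint_radialArc_vertices hJ _ _
  · intro i
    fin_cases i
    · exact S.isPreconnected_circleArc _ _
    · exact S.isPreconnected_circleArc _ _
    · exact S.isPreconnected_radialArc _ _
    · exact S.isPreconnected_radialArc _ _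
  · intro i
    fin_cases i
    · exact S.closure_circleArc_subset_union hJ j.2.le _
    · exact S.closure_circleArc_subset_union hJ j.2 _
    · exact S.closure_radialArc_subset_union hJ j.2 _
    · exact S.closure_radialArc_subset_union hJ j.2 _
  · intro i i'
    fin_cases i <;> fin_cases i' <;>
    first
      | exact S.circleArc_eq_or_disjoint _ _ _ _
      | exact S.radialArc_eq_or_disjoint _ _ _ _
      | exact Or.inr (S.disjoint_circleArc_radialArc _ _ _ _)
      | exact Or.inr (S.disjoint_circleArc_radialArc _ _ _ _).symm

end CircleSubdivision

/-- Distinct members of `s` receive distinct indices, so repeated or superfluous entries of the list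
do no harm. -/
theorem ENNReal.tsum_subtype_le_sum {β ι : Type*} [Fintype ι] {s : Set β} {f : β → ℝ≥0∞}
    {A : ι → β} (h : ∀ x ∈ s, ∃ i, x = A i) : ∑' x : s, f x ≤ ∑ i, f (A i) := by
  have h' : ∀ x : s, ∃ i, (x : β) = A i := fun x => h x x.2
  choose g hg using h'
  have hinj : Function.Injective g := by
    intro x y hxy
    ext
    rw [hg x, hg y, hxy]
  calc ∑' x : s, f x = ∑' x : s, f (A (g x)) := tsum_congr fun x => by rw [← hg x]
    _ ≤ ∑' i, f (A i) := ENNReal.tsum_comp_le_tsum_of_injective hinj fun i => f (A i)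
    _ = ∑ i, f (A i) := tsum_fintype _

/-! ### Partitions of loops along the polar grid -/

namespace CircleSubdivision

variable {N : ℕ} (S : CircleSubdivision N) {J : ℕ} {X : Type*}

theorem exp_I_eq_circle (y : ℝ) :
    Complex.exp (((J - J : ℝ) : ℂ) + y * Complex.I) = (Circle.exp y : ℂ) := by
  simp [Circle.coe_exp]

theorem exists_cell_eq (i : Fin (S.partition J).numCells) :
    ∃ c, (S.partition J).cell i = S.cell J c := ⟨_, rfl⟩

/-- Grid points with values in `X` assemble to a map on the vertices. -/
theorem exists_vertexMap (hJ : 0 < J) (v : ℕ → ℤ → X) (hv : ∀ j k m, v j (k + N * m) = v j k) :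
    ∃ f : (S.partition J).vertices → X, ∀ j k h, j ≤ J →
      f ⟨Complex.exp (((j - J : ℝ) : ℂ) + (S.t k : ℝ) * Complex.I), h⟩ = v j k := by
  have key : ∀ z : (S.partition J).vertices, ∃ p : ℕ × ℤ,
      Complex.exp (((p.1 - J : ℝ) : ℂ) + (S.t p.2 : ℝ) * Complex.I) = z := by
    rintro ⟨z, hz⟩
    have hz0 : z ≠ 0 := by
      rintro rfl
      have h0 := hz.1
      rw [DiscPartition.graph, mem_iUnion] at h0
      obtain ⟨i, hi⟩ := h0
      obtain ⟨_ | ⟨j, k⟩, hc⟩ := S.exists_cell_eq i <;> rw [hc] at hi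
      · rw [frontier_center, mem_sphere_zero_iff_norm, norm_zero] at hi
        exact (Real.exp_pos _).ne hi
      · obtain ⟨x, -, y, -, -, h⟩ := (Complex.mem_frontier_exp_rectangle (S.width_lt _)).1 hi
        exact Complex.exp_ne_zero _ h
    have hzp := Complex.exists_exp_polar hz0
    rw [← hzp] at hz
    obtain ⟨⟨j, -, h1⟩, k, h2⟩ := (S.exp_mem_vertices_iff hJ).1 hz
    exact ⟨(j, k), by simp only [← h1, ← h2]; exact hzp⟩
  choose g hg using key
  refine ⟨fun z => v (g z).1 (g z).2, fun j k h _ => ?_⟩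
  have := hg ⟨_, h⟩
  obtain ⟨h1, m, h2⟩ := Complex.exp_polar_eq_iff.1 this
  have h3 : ((g ⟨_, h⟩).1 : ℝ) = j := by linarith
  rw [S.t_add_two_pi] at h2
  simp only
  rw [S.strictMono.injective h2, hv, Nat.cast_injective h3]

/-- The interval of angles of an arc of the unit circle. -/
theorem exists_shift_subset {I : Set ℝ} (hI : I.OrdConnected) {k : ℤ}
    (h : ∀ s ∈ I, (Circle.exp s : ℂ) ∈ S.circleArc J J k) :
    ∃ m : ℤ, ∀ s ∈ I, s - 2 * Real.pi * m ∈ Ioo (S.t k) (S.t (k + 1)) := by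
  have hm : ∀ s ∈ I, ∃ m : ℤ, s - 2 * Real.pi * m ∈ Ioo (S.t k) (S.t (k + 1)) := by
    intro s hs
    obtain ⟨y, hy, hys⟩ := h s hs
    have hys' : Complex.exp (((J - J : ℝ) : ℂ) + y * Complex.I) =
      Complex.exp (((J - J : ℝ) : ℂ) + s * Complex.I) := by rw [exp_I_eq_circle s]; exact hys
    obtain ⟨-, m, rfl⟩ := Complex.exp_polar_eq_iff.1 hys'
    exact ⟨-m, by push_cast; convert hy using 1; ring⟩
  rcases I.eq_empty_or_nonempty with rfl | ⟨a, ha⟩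
  · exact ⟨0, by simp⟩
  obtain ⟨m, hma⟩ := hm a ha
  refine ⟨m, fun s hs => ?_⟩
  obtain ⟨m', hms⟩ := hm s hs
  have hw := S.width_lt k
  have hpi := Real.pi_pos
  rcases lt_trichotomy m m' with h1 | h1 | h1
  -- If two points of `I` needed different shifts, `I` would contain a translate by a multiple of
  -- `2π` of the grid angle `S.t k`, and such angles never lie over the open arc.
  · exfalso
    have h2 : (m : ℝ) + 1 ≤ m' := by exact_mod_cast h1
    have hmem : S.t k + 2 * Real.pi * m' ∈ I := hI.out ha hs
      ⟨by nlinarith [hma.2], by linarith [hms.1]⟩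
    obtain ⟨m'', h3⟩ := hm _ hmem
    rw [show S.t k + 2 * Real.pi * m' - 2 * Real.pi * m'' = S.t k + 2 * Real.pi * (m' - m'' : ℤ) by
      push_cast; ring, ← S.t_add_mul] at h3
    exact S.t_notMem_Ioo _ _ h3
  · rw [h1]; exact hms
  · exfalso
    have h2 : (m' : ℝ) + 1 ≤ m := by exact_mod_cast h1
    have hmem : S.t k + 2 * Real.pi * m ∈ I := hI.out hs ha
      ⟨by nlinarith [hms.2], by linarith [hma.1]⟩
    obtain ⟨m'', h3⟩ := hm _ hmem
    rw [show S.t k + 2 * Real.pi * m - 2 * Real.pi * m'' = S.t k + 2 * Real.pi * (m - m'' : ℤ) by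
      push_cast; ring, ← S.t_add_mul] at h3
    exact S.t_notMem_Ioo _ _ h3

/-- Translation by a multiple of `2π` is monotone and preserves `γ ∘ Circle.exp`, so every competing
interval can be moved into the standard one without changing the variation. -/
theorem arcLengthOver_circleArc_le [MetricSpace X] (γ : C(Circle, X)) (k : ℤ) :
    arcLengthOver γ (S.circleArc J J k) ≤
      eVariationOn (fun s : ℝ => γ (Circle.exp s)) (Icc (S.t k) (S.t (k + 1))) := by
  refine iSup_le fun I => iSup_le fun hI => iSup_le fun _ => iSup_le fun h => ?_
  obtain ⟨m, hm⟩ := S.exists_shift_subset hI h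
  have : (fun s : ℝ => γ (Circle.exp s)) =
      (fun s : ℝ => γ (Circle.exp s)) ∘ fun s => s - 2 * Real.pi * m := by
    ext s
    simp only [Function.comp_apply]
    congr 1
    ext
    simp only [Circle.coe_exp]
    rw [Complex.exp_eq_exp_iff_exists_int]
    exact ⟨m, by push_cast; ring⟩
  conv_lhs => rw [this]
  exact eVariationOn.comp_le_of_monotoneOn _ _ (fun a _ b _ hab => by simpa using hab)
    fun s hs => (Ioo_subset_Icc_self (hm s hs) : s - 2 * Real.pi * m ∈ Icc _ _)

theorem ediam_image_le [MetricSpace X] {V : Set ℂ} (f : V → X) {s : Set ℂ} {a b : V}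
    (h : ∀ v : V, (v : ℂ) ∈ s → v = a ∨ v = b) :
    Metric.ediam (f '' {v | (v : ℂ) ∈ s}) ≤ edist (f a) (f b) := by
  refine Metric.ediam_le ?_
  rintro _ ⟨v, hv, rfl⟩ _ ⟨w, hw, rfl⟩
  rcases h v hv with rfl | rfl <;> rcases h w hw with rfl | rfl <;>
    simp [edist_comm]


/-- The polar grid bounds the partition number of a loop. -/
theorem partitionNumber_le [MetricSpace X] (hJ : 0 < J) (γ : C(Circle, X)) (v : ℕ → ℤ → X)
    (hv : ∀ j k m, v j (k + N * m) = v j k) (hvγ : ∀ k, v J k = γ (Circle.exp (S.t k)))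
    {ε b δ : ℝ≥0∞} (hε : 4 * ε ≤ b) (hb : b < δ)
    (harc : ∀ k : Fin N, eVariationOn (fun s : ℝ => γ (Circle.exp s))
      (Icc (S.t (k : ℕ)) (S.t ((k : ℕ) + 1))) ≤ ε)
    (hcircle : ∀ j < J, ∀ k : Fin N, edist (v j (k : ℕ)) (v j ((k : ℕ) + 1)) ≤ ε)
    (hradial : ∀ j < J, ∀ k : Fin N, edist (v j (k : ℕ)) (v (j + 1) (k : ℕ)) ≤ ε)
    (hcenter : ∑ k : Fin N, edist (v 0 (k : ℕ)) (v 0 ((k : ℕ) + 1)) ≤ b) :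
    partitionNumber γ δ ≤ (Fintype.card (Option (Fin J × Fin N)) : ℕ∞) := by
  obtain ⟨f, hf⟩ := S.exists_vertexMap hJ v hv
  let Q : LoopPartition γ :=
    { disc := S.partition J
      toFun := f
      eq_on_circle := by
        intro z hz
        have hzp := Complex.exists_exp_polar (Circle.coe_ne_zero z)
        rw [Circle.norm_coe, Real.log_one] at hzp
        have hz' := hz
        rw [← hzp] at hz'
        obtain ⟨⟨j, hj, h1⟩, k, h2⟩ := (S.exp_mem_vertices_iff hJ).1 hz'
        have h3 : Complex.exp (((J - J : ℝ) : ℂ) + (S.t k : ℝ) * Complex.I) = z := by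
          rw [← h2, sub_self]; exact hzp
        have h4 : z = Circle.exp (S.t k) := by ext; rw [← h3, exp_I_eq_circle]
        have h5 := hf J k (h3 ▸ hz) le_rfl
        rw [hvγ, ← h4] at h5
        rw [← h5]
        exact congrArg f (Subtype.ext h3.symm) }
  have hvert : ∀ j ≤ J, ∀ k, Complex.exp (((j - J : ℝ) : ℂ) + (S.t k : ℝ) * Complex.I) ∈
      (S.partition J).vertices := fun j hj k => (S.exp_mem_vertices_iff hJ).2 ⟨⟨j, hj, rfl⟩, k, rfl⟩
  have hlen_radial : ∀ j < J, ∀ k, Q.edgeLength (S.radialArc J j k) ≤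
      edist (v j k) (v (j + 1) k) := by
    intro j hj k
    have hj' : (j : ℝ) + 1 ≤ J := by exact_mod_cast hj
    rw [LoopPartition.edgeLength, if_neg]
    · rw [← hf j k (hvert j hj.le k) hj.le, ← hf (j + 1) k (hvert (j + 1) hj k) hj]
      refine ediam_image_le f ?_
      rintro ⟨z, hz⟩ hz'
      obtain ⟨x, hx, rfl⟩ := S.closure_radialArc_subset j k hz'
      obtain ⟨⟨i, -, rfl⟩, -⟩ := (S.exp_mem_vertices_iff hJ).1 hz
      have h1 : (j : ℝ) ≤ i := by linarith [hx.1]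
      have h2 : (i : ℝ) ≤ (j + 1 : ℕ) := by push_cast; linarith [hx.2]
      have h1' : j ≤ i := by exact_mod_cast h1
      have h2' : i ≤ j + 1 := by exact_mod_cast h2
      rcases (show i = j ∨ i = j + 1 by omega) with rfl | rfl
      · exact Or.inl rfl
      · exact Or.inr rfl
    -- The midpoint of the segment is off the unit circle, so the edge is measured by the distance
    -- of its end points and not by `γ`.
    · intro hsub
      have := hsub ⟨(j + 1 / 2 - J : ℝ), ⟨by linarith, by linarith⟩, rfl⟩
      rw [mem_sphere_zero_iff_norm, Complex.norm_exp_polar, Real.exp_eq_one_iff] at this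
      linarith
  have hlen_circle : ∀ j < J, ∀ k, Q.edgeLength (S.circleArc J j k) ≤
      edist (v j k) (v j (k + 1)) := by
    intro j hj k
    have hj' : (j : ℝ) + 1 ≤ J := by exact_mod_cast hj
    rw [LoopPartition.edgeLength, if_neg]
    · rw [← hf j k (hvert j hj.le k) hj.le, ← hf j (k + 1) (hvert j hj.le (k + 1)) hj.le]
      refine ediam_image_le f ?_
      rintro ⟨z, hz⟩ hz'
      obtain ⟨y, hy, rfl⟩ := S.closure_circleArc_subset j k hz'
      obtain ⟨-, i, rfl⟩ := (S.exp_mem_vertices_iff hJ).1 hz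
      have h1 := S.strictMono.le_iff_le.1 hy.1
      have h2 := S.strictMono.le_iff_le.1 hy.2
      rcases (show i = k ∨ i = k + 1 by omega) with rfl | rfl
      · exact Or.inl rfl
      · exact Or.inr rfl
    · intro hsub
      have hk := S.lt_succ k
      have := hsub ⟨(S.t k + S.t (k + 1)) / 2, ⟨by linarith, by linarith⟩, rfl⟩
      rw [mem_sphere_zero_iff_norm, Complex.norm_exp_polar, Real.exp_eq_one_iff] at this
      linarith
  have hlen_outer : ∀ k, Q.edgeLength (S.circleArc J J k) ≤
      eVariationOn (fun s : ℝ => γ (Circle.exp s)) (Icc (S.t k) (S.t (k + 1))) := by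
    intro k
    rw [LoopPartition.edgeLength, if_pos]
    · exact S.arcLengthOver_circleArc_le γ k
    · rintro _ ⟨y, -, rfl⟩
      rw [mem_sphere_zero_iff_norm, Complex.norm_exp_polar, sub_self, Real.exp_zero]
  have hcirc : ∀ j ≤ J, ∀ k : Fin N, Q.edgeLength (S.circleArc J j (k : ℕ)) ≤ ε := by
    intro j hj k
    rcases hj.lt_or_eq with h | rfl
    · exact (hlen_circle j h _).trans (hcircle j h k)
    · exact (hlen_outer _).trans (harc k)
  have hrad : ∀ j < J, ∀ k : ℤ, Q.edgeLength (S.radialArc J j k) ≤ ε := by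
    intro j hj k
    obtain ⟨l, m, rfl⟩ := S.exists_fin k
    rw [S.radialArc_add_mul]
    exact (hlen_radial j hj _).trans (hradial j hj l)
  have hpiece : ∀ i, Q.pieceLength i ≤ b := by
    intro i
    change ∑' E : (S.partition J).edges i, Q.edgeLength E ≤ b
    obtain ⟨_ | ⟨j, k⟩, hc⟩ := S.exists_cell_eq i
    · refine (ENNReal.tsum_subtype_le_sum (A := fun k : Fin N => S.circleArc J 0 (k : ℕ)) ?_).trans
        ((Finset.sum_le_sum fun (k : Fin N) _ => hlen_circle 0 hJ (k : ℕ)).trans hcenter)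
      intro E hE
      obtain ⟨x, hx, rfl⟩ := hE
      rw [hc] at hx ⊢
      exact S.edge_of_center hJ hx
    · refine (ENNReal.tsum_subtype_le_sum (A := ![S.circleArc J j (k : ℕ),
        S.circleArc J (j + 1) (k : ℕ), S.radialArc J j (k : ℕ),
        S.radialArc J j ((k : ℕ) + 1)]) ?_).trans (le_trans ?_ hε)
      · intro E hE
        obtain ⟨x, hx, rfl⟩ := hE
        rw [hc] at hx ⊢
        exact S.edge_of_sector hJ j k hx
      · have h4 : (4 : ℝ≥0∞) * ε = ∑ _i : Fin 4, ε := by simp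
        rw [h4]
        refine Finset.sum_le_sum fun i _ => ?_
        fin_cases i
        · exact hcirc j j.2.le k
        · exact hcirc (j + 1) j.2 k
        · exact hrad j j.2 _
        · exact hrad j j.2 _
  exact iInf₂_le Q ((iSup_le hpiece).trans_lt hb)

end CircleSubdivision

/-! ### Subdivision of a rectifiable loop into arcs of equal length -/

/-- The one-sided jumps of the variation function equal those of `f`, which vanish by continuity. -/
theorem BoundedVariationOn.continuousOn_variationOnFromTo {X : Type*} [PseudoMetricSpace X]
    {f : ℝ → X} {s : Set ℝ} {a : ℝ} (hf : BoundedVariationOn f s) (hc : ContinuousOn f s)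
    (ha : a ∈ s) : ContinuousOn (variationOnFromTo f s a) s := by
  intro x hx
  have h1 := variationOnFromTo.tendsto_left ha hx hf.locallyBoundedVariationOn
    ((hc x hx).mono_left (nhdsWithin_mono _ inter_subset_left))
  have h2 := variationOnFromTo.tendsto_right ha hx hf.locallyBoundedVariationOn
    ((hc x hx).mono_left (nhdsWithin_mono _ inter_subset_left))
  rw [dist_self, sub_zero] at h1
  rw [dist_self, add_zero] at h2
  have h3 : ContinuousWithinAt (variationOnFromTo f s a) (insert x (s ∩ Iio x ∪ s ∩ Ioi x)) x := by
    rw [continuousWithinAt_insert_self]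
    exact ContinuousWithinAt.union h1 h2
  refine h3.mono fun y hy => ?_
  rcases lt_trichotomy y x with h | h | h
  · exact Or.inr (Or.inl ⟨hy, h⟩)
  · exact Or.inl h
  · exact Or.inr (Or.inr ⟨hy, h⟩)

section

variable {X : Type*} [MetricSpace X]

/-- Constant speed times of a rectifiable loop. -/
theorem exists_constantSpeed_times (γ : C(Circle, X)) (hfin : loopLength γ ≠ ⊤)
    (hpos : 0 < (loopLength γ).toReal) : ∃ σ : ℝ → ℝ, σ 0 = 0 ∧ σ 1 = 2 * Real.pi ∧
      StrictMonoOn σ (Icc 0 1) ∧ ∀ u ∈ Icc (0 : ℝ) 1, ∀ v ∈ Icc (0 : ℝ) 1, u ≤ v →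
        eVariationOn (fun t : ℝ => γ (Circle.exp t)) (Icc (σ u) (σ v)) =
          ENNReal.ofReal ((loopLength γ).toReal * (v - u)) := by
  set f := fun t : ℝ => γ (Circle.exp t) with hf
  set L := (loopLength γ).toReal
  have hpi := Real.two_pi_pos
  set s := Icc 0 (2 * Real.pi)
  have hbv : BoundedVariationOn f s := hfin
  have hlbv := hbv.locallyBoundedVariationOn
  have h0s : (0 : ℝ) ∈ s := ⟨le_rfl, hpi.le⟩
  have h1s : 2 * Real.pi ∈ s := ⟨hpi.le, le_rfl⟩
  have hfc : Continuous f := γ.continuous.comp Circle.exp.continuous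
  have hc := hbv.continuousOn_variationOnFromTo hfc.continuousOn h0s
  set V := variationOnFromTo f s 0
  have hV0 : V 0 = 0 := variationOnFromTo.self _ _ _
  have hV1 : V (2 * Real.pi) = L := by
    simp only [V]
    rw [variationOnFromTo.eq_of_le _ _ hpi.le, inter_self]
    rfl
  have hmono : MonotoneOn V s := variationOnFromTo.monotoneOn hlbv h0s
  -- `V` may be constant on intervals, so the time is a choice, and the end points are prescribed
  -- separately. Strict monotonicity of `σ` still follows from `0 < L`; continuity of `σ` is not
  -- needed.
  have hex : ∀ u : ℝ, ∃ t, u ∈ Icc (0 : ℝ) 1 → t ∈ s ∧ V t = L * u ∧ (u = 0 → t = 0) ∧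
      (u = 1 → t = 2 * Real.pi) := by
    intro u
    by_cases hu : u ∈ Icc (0 : ℝ) 1
    · rcases eq_or_ne u 0 with rfl | h0
      · exact ⟨0, fun _ => ⟨h0s, by simp [hV0], fun _ => rfl, by simp⟩⟩
      rcases eq_or_ne u 1 with rfl | h1
      · exact ⟨2 * Real.pi, fun _ => ⟨h1s, by simp [hV1], by simp, fun _ => rfl⟩⟩
      obtain ⟨t, ht, htu⟩ := intermediate_value_Icc hpi.le hc
        (show L * u ∈ Icc (V 0) (V (2 * Real.pi)) by
          rw [hV0, hV1]
          exact ⟨mul_nonneg hpos.le hu.1, mul_le_of_le_one_right hpos.le hu.2⟩)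
      exact ⟨t, fun _ => ⟨ht, htu, fun h => absurd h h0, fun h => absurd h h1⟩⟩
    · exact ⟨0, fun h => absurd h hu⟩
  choose σ hσ using hex
  have hsm : StrictMonoOn σ (Icc 0 1) := by
    intro u hu v hv huv
    by_contra! hle
    have := hmono (hσ v hv).1 (hσ u hu).1 hle
    rw [(hσ u hu).2.1, (hσ v hv).2.1] at this
    nlinarith
  refine ⟨σ, (hσ 0 (by simp)).2.2.1 rfl, (hσ 1 (by simp)).2.2.2 rfl, hsm, ?_⟩
  intro u hu v hv huv
  have hle := hsm.monotoneOn hu hv huv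
  have h1 := variationOnFromTo.add hlbv h0s (hσ u hu).1 (hσ v hv).1
  change V (σ u) + _ = V (σ v) at h1
  rw [(hσ u hu).2.1, (hσ v hv).2.1, variationOnFromTo.eq_of_le _ _ hle] at h1
  have hsub : s ∩ Icc (σ u) (σ v) = Icc (σ u) (σ v) :=
    inter_eq_right.2 (Icc_subset_Icc (hσ u hu).1.1 (hσ v hv).1.2)
  rw [hsub] at h1
  have hfin' : eVariationOn f (Icc (σ u) (σ v)) ≠ ⊤ :=
    ((eVariationOn.mono f (Icc_subset_Icc (hσ u hu).1.1 (hσ v hv).1.2)).trans_lt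
      hfin.lt_top).ne
  rw [← ENNReal.ofReal_toReal hfin']
  congr 1
  linarith

/-- The periodic subdivision with prescribed points in one period. -/
theorem exists_circleSubdivision {σ : ℝ → ℝ} (h0 : σ 0 = 0) (h1 : σ 1 = 2 * Real.pi)
    (hσ : StrictMonoOn σ (Icc 0 1)) {N : ℕ} (hN : 2 ≤ N) :
    ∃ S : CircleSubdivision N, (∀ i : ℕ, i ≤ N → S.t i = σ (i / N)) ∧
      ∀ k : ℤ, Circle.exp (S.t k) = Circle.exp (σ ((k % N).toNat / N)) := by
  have hN0 : (0 : ℤ) < N := by omega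
  have hNr : (0 : ℝ) < N := by exact_mod_cast hN0
  have hmem : ∀ i : ℕ, i ≤ N → (i / N : ℝ) ∈ Icc (0 : ℝ) 1 := fun i hi =>
    ⟨by positivity, (div_le_one hNr).2 (by exact_mod_cast hi)⟩
  let t : ℤ → ℝ := fun k => σ ((k % N).toNat / N) + 2 * Real.pi * (k / N : ℤ)
  have hsplit : ∀ k : ℤ, ∃ (r : ℕ) (q : ℤ), r < N ∧ k = r + N * q := by
    intro k
    have h1 := Int.emod_nonneg k hN0.ne'
    have h2 := Int.emod_lt_of_pos k hN0
    refine ⟨(k % N).toNat, k / N, by omega, ?_⟩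
    rw [Int.toNat_of_nonneg h1]
    exact (Int.emod_add_mul_ediv k N).symm
  have hmod : ∀ (r : ℕ) (q : ℤ), r < N → ((r + N * q : ℤ) % N).toNat = r := by
    intro r q hr
    rw [Int.add_mul_emod_self_left, Int.emod_eq_of_lt (by omega) (by omega)]
    simp
  have hdiv : ∀ (r : ℕ) (q : ℤ), r < N → (r + N * q : ℤ) / N = q := by
    intro r q hr
    rw [Int.add_mul_ediv_left _ _ hN0.ne', Int.ediv_eq_zero_of_lt (by omega) (by omega), zero_add]
  have ht : ∀ (r : ℕ) (q : ℤ), r ≤ N → t (r + N * q) = σ (r / N) + 2 * Real.pi * q := by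
    intro r q hr
    rcases hr.lt_or_eq with h | rfl
    · simp only [t]
      rw [hmod r q h, hdiv r q h]
    -- The last point of one period is the first point of the next; `h0` and `h1` make the two
    -- formulas agree.
    · have e : (r : ℤ) + r * q = (0 : ℕ) + r * (q + 1) := by push_cast; ring
      simp only [t]
      rw [e, hmod 0 _ (by omega), hdiv 0 _ (by omega), div_self hNr.ne', h1]
      simp only [Nat.cast_zero, zero_div, h0]
      push_cast; ring
  refine ⟨⟨t, ?_, ?_, hN⟩, ?_, ?_⟩
  · refine strictMono_int_of_lt_succ fun k => ?_
    obtain ⟨r, q, hr, rfl⟩ := hsplit k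
    rw [show (r : ℤ) + N * q + 1 = (r + 1 : ℕ) + N * q by push_cast; ring, ht r q hr.le,
      ht (r + 1) q hr]
    have : σ (r / N) < σ ((r + 1 : ℕ) / N) :=
      hσ (hmem r hr.le) (hmem (r + 1) hr) (div_lt_div_of_pos_right (by push_cast; linarith) hNr)
    linarith
  · intro k
    obtain ⟨r, q, hr, rfl⟩ := hsplit k
    rw [show (r : ℤ) + N * q + N = r + N * (q + 1) by ring, ht r q hr.le, ht r (q + 1) hr.le]
    push_cast; ring
  · intro i hi
    have := ht i 0 hi
    simpa using this
  · intro k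
    simp only [t]
    ext
    simp only [Circle.coe_exp]
    rw [Complex.exp_eq_exp_iff_exists_int]
    exact ⟨k / N, by push_cast; ring⟩

end

/-! ### Choosing loops of prescribed scale -/

theorem loopLength_toReal_succ_le {X : Type*} [MetricSpace X] {α : ℕ → C(Circle, X)}
    (hfin : ∀ n, loopLength (α n) ≠ ⊤) {C : ℝ≥0}
    (hC : ∀ n, loopLength (α (n + 1)) / loopLength (α n) ≤ C) (n : ℕ) :
    (loopLength (α (n + 1))).toReal ≤ C * (loopLength (α n)).toReal := by
  have h : loopLength (α (n + 1)) ≤ C * loopLength (α n) := by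
    -- In `ℝ≥0∞` a non-zero length divided by `0` is `⊤`, so the bound forces the next length to
    -- vanish as well.
    rcases eq_or_ne (loopLength (α n)) 0 with h0 | h0
    · have := hC n
      rw [h0] at this ⊢
      by_contra! hc
      rw [mul_zero] at hc
      rw [ENNReal.div_zero hc.ne'] at this
      simp at this
    · exact (ENNReal.div_le_iff h0 (hfin n)).1 (hC n)
  have := ENNReal.toReal_mono (ENNReal.mul_ne_top ENNReal.coe_ne_top (hfin n)) h
  simpa using this

/-- If a sequence tends to infinity with bounded ratios, its terms hit every large scale up to a
constant factor. -/
theorem exists_subsequence_of_scale {L : ℕ → ℝ} {C : ℝ} (hC : 0 ≤ C)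
    (hratio : ∀ n, L (n + 1) ≤ C * L n) (hL : Tendsto L atTop atTop) {ι : Type*} {l : Filter ι}
    {s : ι → ℝ} (hs : Tendsto s l atTop) : ∃ m : ι → ℕ, Tendsto m l atTop ∧
      ∀ᶠ n in l, s n ≤ L (m n) ∧ L (m n) ≤ C * s n := by
  classical
  have hex : ∀ n, ∃ m, s n ≤ L m := fun n => (hL.eventually_ge_atTop (s n)).exists
  -- At the first index where `L` reaches `s n`, the preceding term is below `s n`, so the ratio
  -- bound controls the overshoot. A preceding term exists once `s n` exceeds `L 0`.
  refine ⟨fun n => Nat.find (hex n), ?_, ?_⟩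
  · refine tendsto_atTop.2 fun K => ?_
    have : ∀ᶠ n in l, ∀ m ∈ Finset.range K, L m < s n :=
      (Finset.eventually_all _).2 fun m _ => hs.eventually_gt_atTop (L m)
    filter_upwards [this] with n hn
    by_contra! hlt
    exact (hn _ (Finset.mem_range.2 hlt)).not_ge (Nat.find_spec (hex n))
  · filter_upwards [hs.eventually_gt_atTop (L 0)] with n hn
    refine ⟨Nat.find_spec (hex n), ?_⟩
    obtain ⟨m, hm⟩ : ∃ m, Nat.find (hex n) = m + 1 := by
      refine Nat.exists_eq_succ_of_ne_zero fun h0 => ?_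
      have := Nat.find_spec (hex n)
      rw [h0] at this
      linarith
    have h1 : L m < s n := not_le.1 (Nat.find_min (hex n) (by omega))
    rw [hm]
    exact (hratio m).trans (mul_le_mul_of_nonneg_left h1.le hC)

/-! ### Essential loops in the asymptotic cone -/

section

open scoped unitInterval

variable {X : Type*} [MetricSpace X] {ω : Ultrafilter ℕ} {d : ScalingSequence ω} {e : ℕ → X}

namespace AsymptoticCone

theorem tendsto_dist_mk (x y : ConeSequence d e) :
    Tendsto (fun n => dist (x.1 n) (y.1 n) / d.toFun n) (ω : Filter ℕ)
      (𝓝 (dist (SeparationQuotient.mk x : AsymptoticCone d e) (SeparationQuotient.mk y))) := by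
  rw [SeparationQuotient.dist_mk]
  exact ConeSequence.tendsto_dist x y

theorem eventually_dist_le {x y : ConeSequence d e} {c : ℝ}
    (h : dist (SeparationQuotient.mk x : AsymptoticCone d e) (SeparationQuotient.mk y) < c) :
    ∀ᶠ n in (ω : Filter ℕ), dist (x.1 n) (y.1 n) ≤ c * d.toFun n := by
  filter_upwards [(tendsto_dist_mk x y).eventually_lt_const h] with n hn
  exact ((div_lt_iff₀ (d.pos n)).1 hn).le

theorem dist_mk_le {x y : ConeSequence d e} {c : ℝ}
    (h : ∀ᶠ n in (ω : Filter ℕ), dist (x.1 n) (y.1 n) ≤ c * d.toFun n) :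
    dist (SeparationQuotient.mk x : AsymptoticCone d e) (SeparationQuotient.mk y) ≤ c := by
  refine le_of_tendsto (tendsto_dist_mk x y) ?_
  filter_upwards [h] with n hn
  exact (div_le_iff₀ (d.pos n)).2 hn

end AsymptoticCone

/-- The `i`-th of the `N + 1` equidistant points of the unit interval. -/
noncomputable def gridPoint (N i : ℕ) : I := projIcc 0 1 zero_le_one (i / N)

theorem gridPoint_coe {N i : ℕ} (hN : 0 < N) (hi : i ≤ N) : (gridPoint N i : ℝ) = i / N := by
  have hNr : (0 : ℝ) < N := by exact_mod_cast hN
  rw [gridPoint, projIcc_of_mem zero_le_one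
    ⟨by positivity, (div_le_one hNr).2 (by exact_mod_cast hi)⟩]

theorem gridPoint_zero (N : ℕ) : gridPoint N 0 = 0 := by
  simp [gridPoint]

theorem gridPoint_self {N : ℕ} (hN : 0 < N) : gridPoint N N = 1 := by
  ext
  rw [gridPoint_coe hN le_rfl]
  simp [hN.ne']

theorem dist_gridPoint_succ {N i : ℕ} (hN : 0 < N) (hi : i < N) :
    dist (gridPoint N i) (gridPoint N (i + 1)) = 1 / N := by
  rw [Subtype.dist_eq, gridPoint_coe hN hi.le, gridPoint_coe hN hi, Real.dist_eq, abs_sub_comm]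
  push_cast
  rw [show ((i : ℝ) + 1) / N - i / N = 1 / N by ring, abs_of_nonneg (by positivity)]

/-- A loop in the cone that is the limit of rescaled loops with unbounded partition numbers is not
homotopic to a shorter loop. -/
theorem not_homotopic_of_tendsto_partitionNumber {p : AsymptoticCone d e} {ζ : ℕ → C(Circle, X)}
    (hfin : ∀ n, loopLength (ζ n) ≠ ⊤) {M r A : ℝ} (hM : 0 < M)
    (hr : 0 < r)
    (hpn : Tendsto (fun n => partitionNumber (ζ n) (loopLength (ζ n) / ENNReal.ofReal M))
      (ω : Filter ℕ) (𝓝 ⊤))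
    (hlow : ∀ᶠ n in (ω : Filter ℕ), r * d.toFun n ≤ (loopLength (ζ n)).toReal)
    (hupp : ∀ᶠ n in (ω : Filter ℕ), (loopLength (ζ n)).toReal ≤ A * d.toFun n)
    (f : ℕ → X ≃ᵢ X) (τ : ℕ → ℝ → ℝ)
    (hτ : ∀ n, 0 < (loopLength (ζ n)).toReal → τ n 0 = 0 ∧ τ n 1 = 2 * Real.pi ∧
      StrictMonoOn (τ n) (Icc 0 1) ∧ ∀ u ∈ Icc (0 : ℝ) 1, ∀ v ∈ Icc (0 : ℝ) 1, u ≤ v →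
        eVariationOn (fun t : ℝ => ζ n (Circle.exp t)) (Icc (τ n u) (τ n v)) =
          ENNReal.ofReal ((loopLength (ζ n)).toReal * (v - u)))
    (γ : Path p p)
    (g : I → ConeSequence d e) (hg : ∀ u n, (g u).1 n = f n (ζ n (Circle.exp (τ n u))))
    (hγ : ∀ u, γ u = SeparationQuotient.mk (g u))
    (η : Path p p) {c : ℝ} (hc : c < r / M) (hη : ∀ s t, dist (η s) (η t) ≤ c * dist s t) :
    ¬ γ.Homotopic η := by
  rintro ⟨H⟩
  -- Every piece will have length at most `θ * d n`, which is less than `|ζ n| / M` because `θ < r /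
  -- M`; the gap above `c` absorbs the passage to the limit in the central cell.
  obtain ⟨θ, hcθ, hθr⟩ := exists_between (max_lt hc (div_pos hr hM))
  have hθ0 : 0 < θ := (le_max_right _ _).trans_lt hcθ
  have hcθ' : c < θ := (le_max_left _ _).trans_lt hcθ
  have huc : UniformContinuous H := CompactSpace.uniformContinuous_of_continuous H.continuous
  obtain ⟨ρ, hρ, hunif⟩ := Metric.uniformContinuous_iff.1 huc (θ / 4) (by positivity)
  -- The three bounds give a legitimate subdivision, grid steps below the modulus of continuity of
  -- `H`, and boundary arcs of length at most `θ / 4 * d n`.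
  obtain ⟨N, hN⟩ := exists_nat_gt (max 2 (max (1 / ρ) (A / (θ / 4))))
  have hN2 : 2 ≤ N := by
    have : (2 : ℝ) < N := (le_max_left _ _).trans_lt hN
    exact_mod_cast this.le
  have hN0 : 0 < N := by omega
  have hNr : (0 : ℝ) < N := by exact_mod_cast hN0
  have hNρ : 1 / (N : ℝ) < ρ := by
    have : 1 / ρ < N := ((le_max_left _ _).trans (le_max_right _ _)).trans_lt hN
    rw [div_lt_iff₀ hρ] at this
    rw [div_lt_iff₀ hNr]; linarith
  have hNA : A / N < θ / 4 := by
    have : A / (θ / 4) < N := ((le_max_right _ _).trans (le_max_right _ _)).trans_lt hN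
    rw [div_lt_iff₀ (by positivity)] at this
    rw [div_lt_iff₀ hNr]; linarith
  -- the grid of points in the cone and its lift
  let G : ℕ → ℕ → AsymptoticCone d e := fun j i => H (gridPoint N (N - j), gridPoint N i)
  have hper : ∀ j, G j N = G j 0 := by
    intro j
    simp only [G, gridPoint_self hN0, gridPoint_zero]
    rw [H.source, H.target]
  -- On the outer row the lift must be `g` itself and not merely an equivalent sequence, since the
  -- vertex map has to agree with the loop exactly.
  have hG : ∀ j i, ∃ x : ConeSequence d e, SeparationQuotient.mk x = G j i ∧
      (j = N → x = g (gridPoint N i)) := by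
    intro j i
    by_cases hj : j = N
    · refine ⟨g (gridPoint N i), ?_, fun _ => rfl⟩
      rw [← hγ]
      simp only [G, hj, Nat.sub_self, gridPoint_zero]
      exact (H.apply_zero _).symm
    · obtain ⟨x, hx⟩ := SeparationQuotient.surjective_mk (G j i)
      exact ⟨x, hx, fun h => absurd h hj⟩
  choose R hR hRN using hG
  let κ : ℤ → ℕ := fun k => (k % N).toNat
  have hκ : ∀ j, ∀ k : Fin N, G j (κ (k : ℕ)) = G j k := by
    intro j k
    congr 1
    have := k.2
    simp only [κ]
    rw [Int.emod_eq_of_lt (by omega) (by omega)]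
    simp
  have hκ' : ∀ j, ∀ k : Fin N, G j (κ ((k : ℕ) + 1)) = G j (k + 1) := by
    intro j k
    have := k.2
    rcases (show (k : ℕ) + 1 < N ∨ (k : ℕ) + 1 = N by omega) with h | h
    · congr 1
      simp only [κ]
      rw [Int.emod_eq_of_lt (by omega) (by omega)]
      simp
    · have h' : ((k : ℕ) : ℤ) + 1 = N := by exact_mod_cast h
      rw [h, hper]
      simp only [κ, h', Int.emod_self, Int.toNat_zero]
  -- distances in the cone
  have hdc : ∀ j < N, ∀ k : Fin N, dist (G j k) (G j (k + 1)) < θ / 4 := by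
    intro j _ k
    refine hunif ?_
    rw [Prod.dist_eq, dist_self, dist_gridPoint_succ hN0 k.2]
    exact max_lt hρ hNρ
  have hdr : ∀ j < N, ∀ k : Fin N, dist (G j k) (G (j + 1) k) < θ / 4 := by
    intro j hj k
    refine hunif ?_
    rw [Prod.dist_eq, dist_self, dist_comm, show N - j = N - (j + 1) + 1 by omega,
      dist_gridPoint_succ hN0 (by omega)]
    exact max_lt hNρ hρ
  have hd0 : ∀ k : Fin N, dist (G 0 k) (G 0 (k + 1)) ≤ c * (1 / N) := by
    intro k
    rw [← dist_gridPoint_succ hN0 k.2]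
    simp only [G, Nat.sub_zero, gridPoint_self hN0]
    have h1 : ∀ t, H (1, t) = η t := H.apply_one
    rw [h1, h1]
    exact hη _ _
  -- The central polygon has `N` sides, so uniform continuity alone would not bound its perimeter;
  -- the Lipschitz constant of `η` does, uniformly in `N`.
  have hsum : ∑ k : Fin N, dist (G 0 k) (G 0 (k + 1)) < θ := by
    refine (Finset.sum_le_sum fun k _ => hd0 k).trans_lt ?_
    rw [Finset.sum_const, Finset.card_univ, Fintype.card_fin, nsmul_eq_mul]
    rw [show (N : ℝ) * (c * (1 / N)) = c by field_simp]
    exact hcθ'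
  have hevsum : ∀ᶠ n in (ω : Filter ℕ),
      ∑ k : Fin N, dist ((R 0 (κ (k : ℕ))).1 n) ((R 0 (κ ((k : ℕ) + 1))).1 n) / d.toFun n < θ := by
    refine Tendsto.eventually_lt_const hsum (tendsto_finsetSum _ fun k _ => ?_)
    have := AsymptoticCone.tendsto_dist_mk (R 0 (κ (k : ℕ))) (R 0 (κ ((k : ℕ) + 1)))
    rw [hR, hR, hκ', hκ] at this
    exact this
  have hevc : ∀ᶠ n in (ω : Filter ℕ), ∀ j : Fin N, ∀ k : Fin N,
      dist ((R j (κ (k : ℕ))).1 n) ((R j (κ ((k : ℕ) + 1))).1 n) ≤ θ / 4 * d.toFun n := by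
    refine eventually_all.2 fun j => eventually_all.2 fun k => AsymptoticCone.eventually_dist_le ?_
    rw [hR, hR, hκ', hκ]
    exact hdc j j.2 k
  have hevr : ∀ᶠ n in (ω : Filter ℕ), ∀ j : Fin N, ∀ k : Fin N,
      dist ((R j (κ (k : ℕ))).1 n) ((R (j + 1) (κ (k : ℕ))).1 n) ≤ θ / 4 * d.toFun n := by
    refine eventually_all.2 fun j => eventually_all.2 fun k => AsymptoticCone.eventually_dist_le ?_
    rw [hR, hR, hκ, hκ]
    exact hdr j j.2 k
  have hevP := hpn.eventually_const_lt (ENat.natCast_lt_top (Fintype.card (Option (Fin N × Fin N))))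
  -- `N` was fixed before `n`, so only finitely many `ω`-almost sure conditions have to hold at
  -- once.
  obtain ⟨n, h1, h2, h3, h4, h5, h6⟩ :=
    (hevsum.and (hevc.and (hevr.and (hlow.and (hupp.and hevP))))).exists
  have hdn := d.pos n
  have hLpos : 0 < (loopLength (ζ n)).toReal := (mul_pos hr hdn).trans_le h4
  obtain ⟨hτ0, hτ1, hτm, hτv⟩ := hτ n hLpos
  obtain ⟨S, hS1, hS2⟩ := exists_circleSubdivision hτ0 hτ1 hτm hN2
  have hed : ∀ {x y : X} {a : ℝ}, dist x y ≤ a * d.toFun n →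
      edist ((f n).symm x) ((f n).symm y) ≤ ENNReal.ofReal (a * d.toFun n) := by
    intro x y a h
    rw [(f n).symm.isometry.edist_eq, edist_dist]
    exact ENNReal.ofReal_le_ofReal h
  refine h6.not_ge (S.partitionNumber_le (J := N) hN0 (ζ n)
    (fun j k => (f n).symm ((R j (κ k)).1 n)) ?_ ?_ (ε := ENNReal.ofReal (θ / 4 * d.toFun n))
    (b := ENNReal.ofReal (θ * d.toFun n)) ?_ ?_ ?_ ?_ ?_ ?_)
  · intro j k m
    simp only [κ, Int.add_mul_emod_self_left]
  · intro k
    have hlt := Int.emod_lt_of_pos k (show (0 : ℤ) < N by omega)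
    change (f n).symm ((R N (κ k)).1 n) = _
    rw [hRN N _ rfl, hg, IsometryEquiv.symm_apply_apply, hS2,
      gridPoint_coe hN0 (show κ k ≤ N by simp only [κ]; omega)]
  · rw [show (4 : ℝ≥0∞) = ENNReal.ofReal 4 by simp, ← ENNReal.ofReal_mul (by norm_num)]
    exact ENNReal.ofReal_le_ofReal (by linarith)
  · rw [← ENNReal.ofReal_toReal (hfin n), ← ENNReal.ofReal_div_of_pos hM,
      ENNReal.ofReal_lt_ofReal_iff (by positivity), lt_div_iff₀ hM]
    rw [lt_div_iff₀ hM] at hθr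
    nlinarith
  · intro k
    have hk := k.2
    have e1 := hS1 k hk.le
    have e2 := hS1 (k + 1) hk
    push_cast at e2
    have hmem : ∀ i : ℕ, i ≤ N → (i / N : ℝ) ∈ Icc (0 : ℝ) 1 := fun i hi =>
      ⟨by positivity, (div_le_one hNr).2 (by exact_mod_cast hi)⟩
    have hm2 := hmem (k + 1) hk
    push_cast at hm2
    rw [e1, e2, hτv _ (hmem k hk.le) _ hm2 (by gcongr; linarith)]
    refine ENNReal.ofReal_le_ofReal ?_
    rw [show ((k : ℕ) + 1 : ℝ) / N - (k : ℕ) / N = 1 / N by ring]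
    calc (loopLength (ζ n)).toReal * (1 / N) ≤ A * d.toFun n * (1 / N) := by gcongr
      _ = A / N * d.toFun n := by ring
      _ ≤ θ / 4 * d.toFun n := by gcongr
  · intro j hj k
    exact hed (h2 ⟨j, hj⟩ k)
  · intro j hj k
    exact hed (h3 ⟨j, hj⟩ k)
  · simp only [(f n).symm.isometry.edist_eq, edist_dist]
    rw [← ENNReal.ofReal_sum_of_nonneg fun _ _ => dist_nonneg]
    refine ENNReal.ofReal_le_ofReal ?_
    rw [← Finset.sum_div, div_lt_iff₀ hdn] at h1
    exact h1.le

/-- Essential loops at every point of the cone and at every scale. -/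
theorem exists_essential_loop (hhom : IsHomogeneousMetricSpace X) {α : ℕ → C(Circle, X)}
    (hα : AbsolutelyNonDivisible α) : ∃ C M : ℝ, 0 < C ∧ 0 < M ∧
      ∀ (ω : Ultrafilter ℕ) (d : ScalingSequence ω) (e : ℕ → X) (p : AsymptoticCone d e) (r : ℝ),
        0 < r → ∃ γ : Path p p, (∀ s t, dist (γ s) (γ t) ≤ C * r * dist s t) ∧
          ∀ (η : Path p p) (c : ℝ), c < r / M → (∀ s t, dist (η s) (η t) ≤ c * dist s t) →
            ¬ γ.Homotopic η := by
  obtain ⟨hfin, ⟨M, hM, hP⟩, hlen, C₀, hC₀⟩ := hα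
  refine ⟨C₀ + 1, M, by positivity, hM, fun ω d e p r hr => ?_⟩
  obtain ⟨x, rfl⟩ := SeparationQuotient.surjective_mk p
  have hL : Tendsto (fun n => (loopLength (α n)).toReal) atTop atTop := by
    refine tendsto_atTop.2 fun b => ?_
    filter_upwards [hlen.eventually_const_lt (ENNReal.ofReal_lt_top (r := b))] with n hn
    exact (ENNReal.ofReal_le_iff_le_toReal (hfin n)).1 hn.le
  obtain ⟨m, hm, hscale⟩ := exists_subsequence_of_scale C₀.2
    (loopLength_toReal_succ_le hfin hC₀) hL (d.diverges.const_mul_atTop hr)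
  have hlow : ∀ᶠ n in (ω : Filter ℕ), r * d.toFun n ≤ (loopLength (α (m n))).toReal :=
    hscale.mono fun n hn => hn.1
  -- `C₀ + 1` replaces `C₀` only to make the constant positive.
  have hupp : ∀ᶠ n in (ω : Filter ℕ),
      (loopLength (α (m n))).toReal ≤ (C₀ + 1) * r * d.toFun n := by
    filter_upwards [hscale] with n hn
    refine hn.2.trans ?_
    have := mul_pos hr (d.pos n)
    change (C₀ : ℝ) * (r * d.toFun n) ≤ _
    nlinarith
  choose f hf using fun n => hhom (α (m n) 1) (x.1 n)
  have hτex : ∀ n, ∃ τ : ℝ → ℝ, 0 < (loopLength (α (m n))).toReal → τ 0 = 0 ∧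
      τ 1 = 2 * Real.pi ∧ StrictMonoOn τ (Icc 0 1) ∧
      ∀ u ∈ Icc (0 : ℝ) 1, ∀ v ∈ Icc (0 : ℝ) 1, u ≤ v →
        eVariationOn (fun t : ℝ => α (m n) (Circle.exp t)) (Icc (τ u) (τ v)) =
          ENNReal.ofReal ((loopLength (α (m n))).toReal * (v - u)) := by
    intro n
    by_cases h : 0 < (loopLength (α (m n))).toReal
    · obtain ⟨τ, hτ⟩ := exists_constantSpeed_times _ (hfin (m n)) h
      exact ⟨τ, fun _ => hτ⟩
    · exact ⟨id, fun h' => absurd h' h⟩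
  choose τ hτ using hτex
  have hgood : ∀ᶠ n in (ω : Filter ℕ), 0 < (loopLength (α (m n))).toReal := by
    filter_upwards [hlow] with n hn
    exact (mul_pos hr (d.pos n)).trans_le hn
  have hdist : ∀ u v : I, ∀ᶠ n in (ω : Filter ℕ),
      dist (f n (α (m n) (Circle.exp (τ n u)))) (f n (α (m n) (Circle.exp (τ n v)))) ≤
        (C₀ + 1) * r * dist u v * d.toFun n := by
    have key : ∀ u v : I, u ≤ v → ∀ᶠ n in (ω : Filter ℕ),
        dist (f n (α (m n) (Circle.exp (τ n u)))) (f n (α (m n) (Circle.exp (τ n v)))) ≤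
          (C₀ + 1) * r * dist u v * d.toFun n := by
      intro u v huv
      have huv' : (u : ℝ) ≤ v := huv
      filter_upwards [hgood, hupp] with n h1 h2
      obtain ⟨-, -, hτm, hτv⟩ := hτ n h1
      have hle := hτm.monotoneOn u.2 v.2 huv'
      have h3 := eVariationOn.edist_le (fun t : ℝ => α (m n) (Circle.exp t))
        (left_mem_Icc.2 hle) (right_mem_Icc.2 hle)
      rw [hτv _ u.2 _ v.2 huv', edist_dist, ENNReal.ofReal_le_ofReal_iff
        (mul_nonneg h1.le (by linarith))] at h3
      rw [(f n).dist_eq, Subtype.dist_eq, dist_comm (u : ℝ), Real.dist_eq,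
        abs_of_nonneg (by linarith)]
      nlinarith
    intro u v
    rcases le_total u v with h | h
    · exact key u v h
    · filter_upwards [key v u h] with n hn
      rwa [dist_comm, dist_comm u v]
  have hbase : ∀ᶠ n in (ω : Filter ℕ), f n (α (m n) (Circle.exp (τ n (0 : I)))) = x.1 n := by
    filter_upwards [hgood] with n hn
    have : τ n ((0 : I) : ℝ) = 0 := (hτ n hn).1
    rw [this, Circle.exp_zero, hf]
  have hbase' : ∀ᶠ n in (ω : Filter ℕ), f n (α (m n) (Circle.exp (τ n (1 : I)))) = x.1 n := by
    filter_upwards [hgood] with n hn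
    have : τ n ((1 : I) : ℝ) = 2 * Real.pi := (hτ n hn).2.1
    rw [this, Circle.exp_two_pi, hf]
  let g : I → ConeSequence d e := fun u =>
    ⟨fun n => f n (α (m n) (Circle.exp (τ n u))), by
      obtain ⟨B, hB⟩ := x.2
      refine ⟨(C₀ + 1) * r * dist u 0 + B, ?_⟩
      filter_upwards [hB, hbase, hdist u 0] with n h1 h2 h3
      rw [h2] at h3
      have hd := d.pos n
      rw [div_lt_iff₀ hd] at h1 ⊢
      calc _ ≤ _ + _ := dist_triangle _ (x.1 n) _
        _ < (C₀ + 1) * r * dist u 0 * d.toFun n + B * d.toFun n := add_lt_add_of_le_of_lt h3 h1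
        _ = _ := by ring⟩
  have hlip : ∀ u v : I, dist (SeparationQuotient.mk (g u) : AsymptoticCone d e)
      (SeparationQuotient.mk (g v)) ≤ (C₀ + 1) * r * dist u v :=
    fun u v => AsymptoticCone.dist_mk_le (hdist u v)
  have hcont : Continuous fun u => (SeparationQuotient.mk (g u) : AsymptoticCone d e) :=
    (LipschitzWith.of_dist_le_mul (K := ⟨(C₀ + 1) * r, by positivity⟩) hlip).continuous
  have hend : ∀ u : I, (∀ᶠ n in (ω : Filter ℕ), f n (α (m n) (Circle.exp (τ n u))) = x.1 n) →
      (SeparationQuotient.mk (g u) : AsymptoticCone d e) = SeparationQuotient.mk x := by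
    intro u hu
    refine dist_le_zero.1 (AsymptoticCone.dist_mk_le ?_)
    filter_upwards [hu] with n hn
    rw [show (g u).1 n = x.1 n from hn, dist_self, zero_mul]
  let γ : Path (SeparationQuotient.mk x : AsymptoticCone d e) (SeparationQuotient.mk x) :=
    { toFun := fun u => SeparationQuotient.mk (g u)
      continuous_toFun := hcont
      source' := hend 0 hbase
      target' := hend 1 hbase' }
  refine ⟨γ, hlip, fun η c hc hη => ?_⟩
  exact not_homotopic_of_tendsto_partitionNumber (ζ := fun n => α (m n)) (fun n => hfin (m n)) hM
    (A := (C₀ + 1) * r) hr (hP.comp hm) hlow hupp f τ hτ γ g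
    (fun _ _ => rfl) (fun _ => rfl) η hc hη

end

/-! ### Infinite concatenations of loops -/

namespace Path

open scoped unitInterval

variable {Y : Type*} [MetricSpace Y] {p : Y}

/-- Each half is traversed at double speed; across the junction the two estimates add up through
`y`. -/
theorem dist_trans_le {x y z : Y} {γ : Path x y} {γ' : Path y z} {K : ℝ}
    (h : ∀ s t, dist (γ s) (γ t) ≤ K / 2 * dist s t)
    (h' : ∀ s t, dist (γ' s) (γ' t) ≤ K / 2 * dist s t) (s t : I) :
    dist ((γ.trans γ') s) ((γ.trans γ') t) ≤ K * dist s t := by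
  have key : ∀ s t : I, s ≤ t → dist ((γ.trans γ') s) ((γ.trans γ') t) ≤ K * dist s t := by
    intro s t hst
    have hst' : (s : ℝ) ≤ t := hst
    have hd : dist s t = t - s := by
      rw [Subtype.dist_eq, dist_comm, Real.dist_eq, abs_of_nonneg (by linarith)]
    rw [hd, trans_apply, trans_apply]
    split_ifs with h1 h2 h2
    · refine (h _ _).trans_eq ?_
      rw [Subtype.dist_eq, dist_comm, Real.dist_eq, abs_of_nonneg (by simp only; linarith)]
      simp only; ring
    · have hs : (2 * s : ℝ) ∈ I := (unitInterval.mul_pos_mem_iff zero_lt_two).2 ⟨s.2.1, h1⟩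
      have ht : (2 * t - 1 : ℝ) ∈ I :=
        unitInterval.two_mul_sub_one_mem_iff.2 ⟨(not_le.1 h2).le, t.2.2⟩
      have a : dist (γ ⟨2 * s, hs⟩) y ≤ K / 2 * (1 - 2 * s) := by
        have := h ⟨2 * s, hs⟩ 1
        rwa [γ.target, Subtype.dist_eq, dist_comm (_ : ℝ), Real.dist_eq, Icc.coe_one,
          abs_of_nonneg (by simp only; linarith)] at this
      have b : dist y (γ' ⟨2 * t - 1, ht⟩) ≤ K / 2 * (2 * t - 1) := by
        have := h' 0 ⟨2 * t - 1, ht⟩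
        rwa [γ'.source, Subtype.dist_eq, dist_comm (_ : ℝ), Real.dist_eq, Icc.coe_zero, sub_zero,
          abs_of_nonneg ht.1] at this
      refine (dist_triangle _ y _).trans ?_
      linarith
    · exact absurd (hst'.trans h2) h1
    · refine (h' _ _).trans_eq ?_
      rw [Subtype.dist_eq, dist_comm, Real.dist_eq, abs_of_nonneg (by simp only; linarith)]
      simp only; ring
  rcases le_total s t with hst | hst
  · exact key s t hst
  · rw [dist_comm, dist_comm s]; exact key t s hst

theorem dist_symm_le {x y : Y} {γ : Path x y} {K : ℝ}
    (h : ∀ s t, dist (γ s) (γ t) ≤ K * dist s t) (s t : I) :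
    dist (γ.symm s) (γ.symm t) ≤ K * dist s t := by
  refine (h _ _).trans_eq ?_
  rw [Subtype.dist_eq, Subtype.dist_eq, Real.dist_eq, Real.dist_eq, abs_sub_comm (s : ℝ)]
  simp

/-- The concatenation of the first `n` loops of a sequence. -/
noncomputable def iterConcat : ℕ → (ℕ → Path p p) → Path p p
  | 0, _ => Path.refl p
  | n + 1, δ => (δ 0).trans (iterConcat n fun k => δ (k + 1))

/-- Loops with geometrically decreasing Lipschitz constants. -/
def Summable (K : ℝ) (δ : ℕ → Path p p) : Prop :=
  0 ≤ K ∧ ∀ k s t, dist (δ k s) (δ k t) ≤ K / 2 ^ (k + 1) * dist s t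

theorem Summable.shift {K : ℝ} {δ : ℕ → Path p p} (h : Summable K δ) :
    Summable (K / 2) fun k => δ (k + 1) := by
  refine ⟨div_nonneg h.1 (by norm_num), fun k s t => (h.2 (k + 1) s t).trans_eq ?_⟩
  rw [div_div, ← pow_succ']

/-- Nesting `trans` speeds up the `k`-th loop by `2 ^ (k + 1)`, which the factor in `Summable`
compensates. The bound is therefore uniform in `n`. -/
theorem Summable.dist_iterConcat_le {K : ℝ} {δ : ℕ → Path p p} (h : Summable K δ) (n : ℕ) (s t : I) :
    dist (iterConcat n δ s) (iterConcat n δ t) ≤ K * dist s t := by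
  induction n generalizing δ K s t with
  | zero =>
    simp only [iterConcat, Path.refl_apply, dist_self]
    exact mul_nonneg h.1 dist_nonneg
  | succ n ih => exact dist_trans_le (by simpa using h.2 0) (fun s t => ih h.shift s t) s t

/-- For `t ≤ 1 - 2⁻ᵏ` the value involves only the first `k` loops, and at `t = 1` it is always `p`.
The values stabilise, so no limit in `Y` has to be taken. -/
theorem exists_eventually_iterConcat (δ : ℕ → Path p p) (t : I) :
    ∃ y, ∀ᶠ n in atTop, iterConcat n δ t = y := by
  have key : ∀ (k : ℕ) (δ : ℕ → Path p p) (t : I), (t : ℝ) ≤ 1 - (1 / 2) ^ k →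
      ∃ y, ∀ᶠ n in atTop, iterConcat n δ t = y := by
    intro k
    induction k with
    | zero =>
      intro δ t ht
      have : t = 0 := by ext; exact le_antisymm (by simpa using ht) t.2.1
      exact ⟨p, Eventually.of_forall fun n => by rw [this, Path.source]⟩
    | succ k ih =>
      intro δ t ht
      by_cases h : (t : ℝ) ≤ 1 / 2
      · refine ⟨δ 0 ⟨2 * t, (unitInterval.mul_pos_mem_iff zero_lt_two).2 ⟨t.2.1, h⟩⟩, ?_⟩
        filter_upwards [eventually_ge_atTop 1] with n hn
        obtain ⟨m, rfl⟩ := Nat.exists_eq_add_of_le' hn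
        rw [iterConcat, trans_apply, dif_pos h]
      · obtain ⟨y, hy⟩ := ih (fun k => δ (k + 1))
          ⟨2 * t - 1, unitInterval.two_mul_sub_one_mem_iff.2 ⟨(not_le.1 h).le, t.2.2⟩⟩ (by
            rw [pow_succ] at ht
            simp only
            linarith)
        refine ⟨y, ?_⟩
        rw [← map_add_atTop_eq_nat 1, eventually_map]
        filter_upwards [hy] with n hn
        rw [iterConcat, trans_apply, dif_neg h, hn]
  rcases eq_or_ne t 1 with rfl | h
  · exact ⟨p, Eventually.of_forall fun n => Path.target _⟩
  · have ht : (t : ℝ) < 1 := lt_of_le_of_ne t.2.2 fun h' => h (Subtype.ext h')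
    obtain ⟨k, hk⟩ := exists_pow_lt_of_lt_one (show 0 < 1 - (t : ℝ) by linarith)
      (show (1 / 2 : ℝ) < 1 by norm_num)
    exact key k δ t (by linarith)

/-- The points of the infinite concatenation of a sequence of loops. -/
noncomputable def concatValue (δ : ℕ → Path p p) (t : I) : Y :=
  (exists_eventually_iterConcat δ t).choose

theorem eventually_iterConcat (δ : ℕ → Path p p) (t : I) :
    ∀ᶠ n in atTop, iterConcat n δ t = concatValue δ t :=
  (exists_eventually_iterConcat δ t).choose_spec

theorem Summable.dist_concatValue_le {K : ℝ} {δ : ℕ → Path p p} (h : Summable K δ) (s t : I) :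
    dist (concatValue δ s) (concatValue δ t) ≤ K * dist s t := by
  obtain ⟨n, h1, h2⟩ := ((eventually_iterConcat δ s).and (eventually_iterConcat δ t)).exists
  rw [← h1, ← h2]
  exact h.dist_iterConcat_le n s t

/-- The infinite concatenation of a sequence of loops. -/
noncomputable def infiniteConcat (δ : ℕ → Path p p) (h : ∃ K, Summable K δ) : Path p p where
  toFun := concatValue δ
  continuous_toFun := by
    obtain ⟨K, hK⟩ := h
    exact (LipschitzWith.of_dist_le_mul (K := ⟨K, hK.1⟩) hK.dist_concatValue_le).continuous
  source' := by
    obtain ⟨n, hn⟩ := (eventually_iterConcat δ 0).exists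
    rw [← hn, Path.source]
  target' := by
    obtain ⟨n, hn⟩ := (eventually_iterConcat δ 1).exists
    rw [← hn, Path.target]

theorem infiniteConcat_eq_trans (δ : ℕ → Path p p) (h : ∃ K, Summable K δ) :
    infiniteConcat δ h = (δ 0).trans (infiniteConcat (fun k => δ (k + 1))
      (h.imp' _ fun _ hK => hK.shift)) := by
  ext t
  change concatValue δ t = _
  have h1 := (tendsto_add_atTop_nat 1).eventually (eventually_iterConcat δ t)
  by_cases ht : (t : ℝ) ≤ 1 / 2
  · obtain ⟨n, hn⟩ := h1.exists
    rw [← hn, iterConcat, trans_apply, trans_apply, dif_pos ht, dif_pos ht]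
  · obtain ⟨n, hn, hn'⟩ := (h1.and (eventually_iterConcat (fun k => δ (k + 1))
      ⟨2 * t - 1, unitInterval.two_mul_sub_one_mem_iff.2 ⟨(not_le.1 ht).le, t.2.2⟩⟩)).exists
    rw [← hn, iterConcat, trans_apply, trans_apply, dif_neg ht, dif_neg ht, hn']
    rfl

/-- Common initial loops of homotopic infinite concatenations may be cancelled. -/
theorem homotopic_infiniteConcat_shift {δ δ' : ℕ → Path p p} (h : ∃ K, Summable K δ)
    (h' : ∃ K, Summable K δ') (hh : (infiniteConcat δ h).Homotopic (infiniteConcat δ' h')) (k : ℕ)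
    (heq : ∀ i < k, δ i = δ' i) :
    ∀ (g : ∃ K, Summable K fun i => δ (i + k)) (g' : ∃ K, Summable K fun i => δ' (i + k)),
      (infiniteConcat _ g).Homotopic (infiniteConcat _ g') := by
  induction k generalizing δ δ' with
  | zero => exact fun _ _ => hh
  | succ k ih =>
    rw [infiniteConcat_eq_trans δ, infiniteConcat_eq_trans δ', ← heq 0 (by omega)] at hh
    have hh2 := Homotopic.Quotient.eq.2 hh
    rw [Homotopic.Quotient.mk_trans, Homotopic.Quotient.mk_trans] at hh2
    -- The product of the group composes in the order opposite to `trans`, so the common first loop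
    -- is the right factor.
    have hh3 := mul_right_cancel (G := FundamentalGroup Y p) hh2
    exact ih _ _ (Homotopic.Quotient.eq.1 hh3) fun i hi => heq (i + 1) (by omega)

end Path

/-! ### Consequences of essential loops at every scale -/

section

open scoped unitInterval

variable {Y : Type*} [MetricSpace Y] {p : Y} {C M : ℝ}

/-- Loops at `p` of every scale that are not homotopic to comparatively short loops. -/
def HasEssentialLoopsAt (C M : ℝ) (p : Y) : Prop :=
  ∀ r : ℝ, 0 < r → ∃ γ : Path p p, (∀ s t, dist (γ s) (γ t) ≤ C * r * dist s t) ∧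
    ∀ (η : Path p p) (c : ℝ), c < r / M → (∀ s t, dist (η s) (η t) ≤ c * dist s t) →
      ¬ γ.Homotopic η

theorem HasEssentialLoopsAt.not_semilocallySimplyConnectedAt (h : HasEssentialLoopsAt C M p)
    (hC : 0 < C) (hM : 0 < M) : ¬ SemilocallySimplyConnectedAt p := by
  rintro ⟨U, hU, hg⟩
  obtain ⟨ε, hε, hball⟩ := Metric.mem_nhds_iff.1 hU
  -- At this scale the loop is `ε / 2`-Lipschitz and stays inside the ball; the competitor is the
  -- constant loop, with `c = 0`.
  have hr : 0 < ε / (2 * C) := by positivity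
  obtain ⟨γ, hγ, hess⟩ := h _ hr
  have hmem : ∀ t, γ t ∈ U := by
    intro t
    apply hball
    have h1 := hγ t 0
    rw [γ.source] at h1
    have h2 : dist t 0 ≤ 1 := by
      rw [Subtype.dist_eq, Real.dist_eq]
      simpa [abs_of_nonneg t.2.1] using t.2.2
    have h3 : C * (ε / (2 * C)) = ε / 2 := by field_simp
    rw [h3] at h1
    rw [Metric.mem_ball]
    nlinarith
  let γU : Path (⟨p, mem_of_mem_nhds hU⟩ : U) ⟨p, mem_of_mem_nhds hU⟩ :=
    { toFun := fun t => ⟨γ t, hmem t⟩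
      continuous_toFun := γ.continuous.subtype_mk _
      source' := Subtype.ext γ.source
      target' := Subtype.ext γ.target }
  have h1 := hg (FundamentalGroup.fromPath (Path.Homotopic.Quotient.mk γU))
  have h2 : Path.Homotopic.Quotient.mk γ = Path.Homotopic.Quotient.mk (Path.refl p) := h1
  exact hess (Path.refl p) 0 (div_pos hr hM) (fun s t => by simp) (Path.Homotopic.Quotient.eq.1 h2)

theorem HasEssentialLoopsAt.uncountable_fundamentalGroup (h : HasEssentialLoopsAt C M p)
    (hC : 0 < C) (hM : 0 < M) : Uncountable (FundamentalGroup Y p) := by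
  -- Two demands on `q`: `q ≤ 1 / 2` makes the families summable, and `4 * C * q * M < 1` makes a
  -- product of two tails too short to replace `γ k`.
  set q : ℝ := 1 / (8 * C * M + 2) with hq
  have hden : 0 < 8 * C * M + 2 := by positivity
  have hq0 : 0 < q := by positivity
  have hq1 : q ≤ 1 / 2 := by
    rw [hq]; exact one_div_le_one_div_of_le (by norm_num) (by nlinarith [mul_pos hC hM])
  have hq2 : 4 * C * q * M < 1 := by
    rw [hq, show 4 * C * (1 / (8 * C * M + 2)) * M = 4 * C * M / (8 * C * M + 2) by ring,
      div_lt_one hden]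
    nlinarith [mul_pos hC hM]
  choose γ hγ hess using fun k : ℕ => h (q ^ k) (pow_pos hq0 k)
  let δ : (ℕ → Bool) → ℕ → Path p p := fun ε k => if ε k then γ k else Path.refl p
  have hδ : ∀ ε k, Path.Summable (2 * C * q ^ k) fun i => δ ε (i + k) := by
    intro ε k
    refine ⟨by positivity, fun i s t => ?_⟩
    have h1 : q ^ i ≤ 1 / 2 ^ i := by
      rw [← one_div_pow]; exact pow_le_pow_left₀ hq0.le hq1 i
    have h2 : C * q ^ (i + k) ≤ 2 * C * q ^ k / 2 ^ (i + 1) := by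
      rw [pow_add, pow_succ, show 2 * C * q ^ k / (2 ^ i * 2) = C * (1 / 2 ^ i * q ^ k) by ring]
      gcongr
    have h3 : 0 ≤ 2 * C * q ^ k / 2 ^ (i + 1) * dist s t := by positivity
    simp only [δ]
    split_ifs
    · exact (hγ _ s t).trans (mul_le_mul_of_nonneg_right h2 dist_nonneg)
    · simpa using h3
  have hδ' : ∀ ε k, ∃ K, Path.Summable K fun i => δ ε (i + k) := fun ε k => ⟨_, hδ ε k⟩
  have hδ₀ : ∀ ε, ∃ K, Path.Summable K (δ ε) := fun ε => ⟨_, hδ ε 0⟩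
  let Φ : (ℕ → Bool) → FundamentalGroup Y p := fun ε =>
    FundamentalGroup.fromPath (Path.Homotopic.Quotient.mk (Path.infiniteConcat _ (hδ₀ ε)))
  have key : ∀ ε ε' : ℕ → Bool, ∀ k, (∀ i < k, ε i = ε' i) → ε k = true → ε' k = false →
      Φ ε ≠ Φ ε' := by
    intro ε ε' k hlt hk hk' hΦ
    have h1 := Path.homotopic_infiniteConcat_shift _ _ (Path.Homotopic.Quotient.eq.1 hΦ) k
      (fun i hi => by simp only [δ, hlt i hi]) (hδ' ε k) (hδ' ε' k)
    rw [Path.infiniteConcat_eq_trans _ (hδ' ε k), Path.infiniteConcat_eq_trans _ (hδ' ε' k)] at h1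
    simp only [δ, zero_add, hk, hk', if_true, Bool.false_eq_true, if_false] at h1
    set T := Path.infiniteConcat _ ((hδ' ε k).imp' _ fun _ hK => hK.shift) with hT
    set T' := Path.infiniteConcat _ ((hδ' ε' k).imp' _ fun _ hK => hK.shift) with hT'
    -- A tail is `2 * C * q ^ (k + 1)`-Lipschitz; the constant is written as a half to fit
    -- `dist_trans_le`.
    have hlip : ∀ ε : ℕ → Bool, ∀ s t,
        dist (Path.concatValue (fun i => δ ε (i + 1 + k)) s)
          (Path.concatValue (fun i => δ ε (i + 1 + k)) t) ≤ 4 * C * q ^ (k + 1) / 2 * dist s t := by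
      intro ε s t
      have := (hδ ε (k + 1)).dist_concatValue_le s t
      have e : (fun i => δ ε (i + 1 + k)) = fun i => δ ε (i + (k + 1)) := by
        ext i; rw [show i + 1 + k = i + (k + 1) by omega]
      rw [e]
      linarith
    -- After cancellation `γ k` followed by `T` is homotopic to the constant loop followed by `T'`;
    -- now solve for `γ k`.
    have h2 : (γ k).Homotopic (T'.trans T.symm) := by
      have h3 := Path.Homotopic.Quotient.eq.2 h1
      rw [Path.Homotopic.Quotient.mk_trans, Path.Homotopic.Quotient.mk_trans,
        Path.Homotopic.Quotient.mk_refl, Path.Homotopic.Quotient.refl_trans] at h3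
      apply Path.Homotopic.Quotient.eq.1
      rw [Path.Homotopic.Quotient.mk_trans, ← h3, Path.Homotopic.Quotient.mk_symm,
        Path.Homotopic.Quotient.trans_assoc, Path.Homotopic.Quotient.trans_symm,
        Path.Homotopic.Quotient.trans_refl]
    refine hess k _ (4 * C * q ^ (k + 1)) ?_ (Path.dist_trans_le (hlip ε')
      (Path.dist_symm_le (hlip ε))) h2
    rw [lt_div_iff₀ hM, pow_succ]
    have := mul_lt_mul_of_pos_left hq2 (pow_pos hq0 k)
    linarith
  have hinj : Function.Injective Φ := by
    intro ε ε' hΦ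
    by_contra hne
    have hex : ∃ k, ε k ≠ ε' k := Function.ne_iff.1 hne
    classical
    have hk := Nat.find_spec hex
    have hlt : ∀ i < Nat.find hex, ε i = ε' i := fun i hi => by
      simpa using Nat.find_min hex hi
    cases h1 : ε (Nat.find hex) <;> cases h2 : ε' (Nat.find hex)
    · exact hk (h1.trans h2.symm)
    · exact key ε' ε _ (fun i hi => (hlt i hi).symm) h2 h1 hΦ.symm
    · exact key ε ε' _ hlt h1 h2 hΦ
    · exact hk (h1.trans h2.symm)
  have : Uncountable (ℕ → Bool) := by
    rw [← Cardinal.aleph0_lt_mk_iff]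
    simpa using Cardinal.cantor Cardinal.aleph0
  exact hinj.uncountable

end

theorem mainTheorem7 {X : Type*} [MetricSpace X] [CompleteSpace X]
    (hgeo : IsGeodesicMetricSpace X) (hhom : IsHomogeneousMetricSpace X)
    (hdiv : ∃ α : ℕ → C(Circle, X), AbsolutelyNonDivisible α)
    (ω : Ultrafilter ℕ) (d : ScalingSequence ω) (e : ℕ → X) :
    (∀ p : AsymptoticCone d e, Uncountable (FundamentalGroup (AsymptoticCone d e) p)) ∧
      ∀ p : AsymptoticCone d e, ¬ SemilocallySimplyConnectedAt p := by
  obtain ⟨α, hα⟩ := hdiv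
  obtain ⟨C, M, hC, hM, h⟩ := exists_essential_loop hhom hα
  have h' : ∀ p : AsymptoticCone d e, HasEssentialLoopsAt C M p := fun p => h ω d e p
  exact ⟨fun p => (h' p).uncountable_fundamentalGroup hC hM,
    fun p => (h' p).not_semilocallySimplyConnectedAt hC hM⟩
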